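/- Let $m,k\ge 1$, $n=m+k$, and write $x=(X_1,X_2)\in\mathbb R^m\times\mathbb R^k=\mathbb R^n$. Let $\omega_1\subset\mathbb R^m$ be open, bounded and convex with $0\in\omega_1$, let $\omega_2\subset\mathbb R^k$ be open and bounded, and put $\Omega_\ell=\ell\omega_1\times\omega_2$ for $\ell>0$. Let $H:\mathbb R^n\to[0,\infty)$ be convex, of class $C^1$ on $\mathbb R^n\setminus\{0\}$, with $H(x)>0$ for $x\ne0$ and $H(tx)=|t|H(x)$ for all $t\in\mathbb R$, $x\in\mathbb R^n$. Let $1\le p<\infty$ and $f\in L^{p'}(\omega_2)$, where $1/p+1/p'=1$. Define $$J_\ell(v)=\int_{\Omega_\ell}\Big\{\frac{H^p(\nabla v)}{p}-f(X_2)\,v\Big\}\,dx\quad (v\in W^{1,p}_0(\Omega_\ell)),$$ $$J_\infty(w)=\int_{\omega_2}\Big\{\frac{H^p(0,\nabla_{X_2}w)}{p}-f\,w\Big\}\,dX_2\quad (w\in W^{1,p}_0(\omega_2)).$$ If $p>1$, let $u_\ell\in W^{1,p}_0(\Omega_\ell)$, for each $\ell>0$, and $u_\infty\in W^{1,p}_0(\omega_2)$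 be weak solutions of the Dirichlet problems $$-\mathrm{div}\big(H^{p-1}(\nabla u_\ell)\nabla H(\nabla u_\ell)\big)=f(X_2)\ \text{ in }\Omega_\ell,\qquad -\mathrm{div}_{X_2}\big(H^{p-1}(0,\nabla_{X_2}u_\infty)\,(\nabla_{Z_2}H)(0,\nabla_{X_2}u_\infty)\big)=f\ \text{ in }\omega_2,$$ tested with all $\phi\in W^{1,p}_0(\Omega_\ell)$, respectively $\phi\in W^{1,p}_0(\omega_2)$. Here $\nabla_{Z_2}H$ is the gradient of $H(Z_1,Z_2)$ in $Z_2\in\mathbb R^k$, and $H^{p-1}\nabla H$ is extended by $0$ at the origin. If $p=1$, let $u_\ell$ (for each $\ell>0$) and $u_\infty$ be minimisers of $J_\ell$ over $W^{1,1}_0(\Omega_\ell)$ and of $J_\infty$ over $W^{1,1}_0(\omega_2)$. Then $$\lim_{\ell\to\infty}\frac{J_\ell(u_\ell)}{|\ell\omega_1|}=J_\infty(u_\infty),$$ and there is a constant $C>0$, independent of $\ell$, such that for all $\ell>0$ $$J_\infty(u_\infty)\le\frac{J_\ell(u_\ell)}{|\ell\omega_1|}\le J_\infty(u_\infty)+\frac{C}{\ell}.$$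 -/

import Mathlib

open MeasureTheory Filter Topology
open scoped Pointwise ContDiff

noncomputable section

namespace FinslerCylinder

section Sobolev

variable {E : Type*} [NormedAddCommGroup E] [InnerProductSpace ℝ E] [FiniteDimensional ℝ E]
  [MeasurableSpace E] [BorelSpace E]

/-- `φ ∈ C_c^∞(Ω)`. -/
structure IsTestFunction (Ω : Set E) (φ : E → ℝ) : Prop where
  smooth : ContDiff ℝ ∞ φ
  compact : HasCompactSupport φ
  subset : tsupport φ ⊆ Ω

/-- `G` is the weak gradient of `u` on `Ω`:
`∫_Ω u ∇φ = - ∫_Ω φ G` (an identity between vectors) for every `φ ∈ C_c^∞(Ω)`. -/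
def HasWeakGradient (Ω : Set E) (u : E → ℝ) (G : E → E) : Prop :=
  ∀ φ : E → ℝ, IsTestFunction Ω φ →
    ∫ x in Ω, u x • gradient φ x = - ∫ x in Ω, φ x • G x

/-- An element of the Sobolev space `W^{1,p}(Ω)`, stored as a function together with (a
representative of) its weak gradient. Values outside `Ω` are irrelevant. -/
structure W1 (p : ℝ) (Ω : Set E) where
  /-- the function -/
  toFun : E → ℝ
  /-- its weak gradient -/
  grad : E → E
  memLp_toFun : MemLp toFun (ENNReal.ofReal p) (volume.restrict Ω)
  memLp_grad : MemLp grad (ENNReal.ofReal p) (volume.restrict Ω)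
  hasWeakGradient : HasWeakGradient Ω toFun grad

/-- An element of `W^{1,p}_0(Ω)`, the closure of `C_c^∞(Ω)` in `W^{1,p}(Ω)`. -/
structure W10 (p : ℝ) (Ω : Set E) extends W1 p Ω where
  mem_closure : ∃ φ : ℕ → E → ℝ, (∀ j, IsTestFunction Ω (φ j)) ∧
    Tendsto (fun j => eLpNorm (fun x => φ j x - toFun x) (ENNReal.ofReal p)
      (volume.restrict Ω)) atTop (𝓝 0) ∧
    Tendsto (fun j => eLpNorm (fun x => gradient (φ j) x - grad x) (ENNReal.ofReal p)
      (volume.restrict Ω)) atTop (𝓝 0)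

/-- The standing hypotheses on the anisotropy `H`. -/
structure IsFinsler (H : E → ℝ) : Prop where
  pos : ∀ x, x ≠ 0 → 0 < H x
  convex : ConvexOn ℝ Set.univ H
  homogeneous : ∀ (t : ℝ) (x : E), H (t • x) = |t| * H x
  contDiffOn : ContDiffOn ℝ 1 H {0}ᶜ

/-- The energy `∫_Ω (H^p(∇v) / p - g v)`. -/
def energy (p : ℝ) (Ω : Set E) (H : E → ℝ) (g : E → ℝ) (v : W10 p Ω) : ℝ :=
  ∫ x in Ω, (H (v.grad x) ^ p / p - g x * v.toFun x)

/-- `u ∈ W^{1,p}_0(Ω)` is a weak solution of `-div (H^{p-1}(∇u) ∇H(∇u)) = g` in `Ω`.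
For `p > 1` the field `H^{p-1} ∇H` is continuous with value `0` at the origin, and this is also the
value of the expression below at the origin, since there `H = 0` and `0 ^ (p - 1) = 0`. -/
def IsWeakSolution (p : ℝ) (Ω : Set E) (H : E → ℝ) (g : E → ℝ) (u : W10 p Ω) : Prop :=
  ∀ φ : W10 p Ω,
    ∫ x in Ω, H (u.grad x) ^ (p - 1) * inner ℝ (gradient H (u.grad x)) (φ.grad x) =
      ∫ x in Ω, g x * φ.toFun x

/-- `u` minimises the energy over `W^{1,p}_0(Ω)`. -/
def IsEnergyMinimizer (p : ℝ) (Ω : Set E) (H : E → ℝ) (g : E → ℝ) (u : W10 p Ω) : Prop :=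
  ∀ v : W10 p Ω, energy p Ω H g u ≤ energy p Ω H g v

/-- `u` solves the Dirichlet problem: for `p > 1` this means that `u` is a weak solution. For
`p = 1` the field `H^{p-1} ∇H = ∇H` has no meaning where the gradient of `u` vanishes, and a
solution is a minimiser of the energy. -/
def IsSolution (p : ℝ) (Ω : Set E) (H : E → ℝ) (g : E → ℝ) (u : W10 p Ω) : Prop :=
  (1 < p → IsWeakSolution p Ω H g u) ∧ (p = 1 → IsEnergyMinimizer p Ω H g u)

end Sobolev

/-- `ℝ^n = ℝ^m × ℝ^k` with its Euclidean norm; a point is `x = (X₁, X₂) = (x.fst, x.snd)`. -/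
abbrev Space (m k : ℕ) : Type :=
  WithLp 2 (EuclideanSpace ℝ (Fin m) × EuclideanSpace ℝ (Fin k))

/-- The cylinder `Ω_ℓ = ℓ ω₁ × ω₂`. -/
def cylinder {m k : ℕ} (ω₁ : Set (EuclideanSpace ℝ (Fin m))) (ω₂ : Set (EuclideanSpace ℝ (Fin k)))
    (ℓ : ℝ) : Set (Space m k) :=
  {x | x.fst ∈ ℓ • ω₁ ∧ x.snd ∈ ω₂}

/-- The restriction `Z₂ ↦ H(0, Z₂)` of `H` to the directions of the cross-section. -/
def crossH {m k : ℕ} (H : Space m k → ℝ) : EuclideanSpace ℝ (Fin k) → ℝ :=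
  fun z => H (WithLp.toLp 2 (0, z))

end FinslerCylinder

end

/-! Both bounds come from comparing minimisers. For `p > 1` a weak solution is a minimiser: the
subgradient inequality for `H ^ p / p`, integrated, turns the weak equation into minimality
(`IsSolution.isEnergyMinimizer`).

Lower bound: average a test function `v` on the cylinder over the slices `ℓ ω₁`. The
`X₁`-derivatives of `v` integrate to zero, so the average of `∇v` over a slice is `(0, ∇ of the
average)`, and Jensen's inequality for the convex function `H ^ p` gives `|ℓ ω₁| J_∞(average) ≤
J_ℓ(v)` (`gradient_sliceAverage`, `energy_sliceAverage_le`). The force depends on `X₂` only, so the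
linear term is preserved exactly. Density extends the bound to all of `W^{1,p}_0`.

Upper bound: compare with `ρ(X₁) w(X₂)`, where `w` approximates `u_∞` and the cutoff `ρ` equals `1`
on `(ℓ - 1) ω₁` with gradient bounded independently of `ℓ` (`exists_cutoff`). On the core the energy
density is that of the cross-section; the remaining layer is a fraction at most `m / ℓ` of `ℓ ω₁`
and costs a bounded amount per unit volume (`exists_energy_le`). For `ℓ ≤ 1` comparison with `0`
suffices. The limit follows by squeezing. -/

noncomputable section

namespace FinslerCylinder

/-! ### Calculus of the norm `H` -/

section Finsler

variable {E : Type*} [NormedAddCommGroup E] [InnerProductSpace ℝ E]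

namespace IsFinsler

variable {H : E → ℝ}

theorem map_zero (hH : IsFinsler H) : H 0 = 0 := by
  simpa using hH.homogeneous 0 0

theorem nonneg (hH : IsFinsler H) (x : E) : 0 ≤ H x := by
  rcases eq_or_ne x 0 with rfl | hx
  · exact hH.map_zero.ge
  · exact (hH.pos x hx).le

theorem map_neg (hH : IsFinsler H) (x : E) : H (-x) = H x := by
  simpa using hH.homogeneous (-1) x

theorem map_add_le (hH : IsFinsler H) (x y : E) : H (x + y) ≤ H x + H y := by
  have h := hH.convex.2 (Set.mem_univ x) (Set.mem_univ y) (show (0 : ℝ) ≤ 1 / 2 by norm_num)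
    (show (0 : ℝ) ≤ 1 / 2 by norm_num) (by norm_num)
  rw [← smul_add, hH.homogeneous, abs_of_pos (by norm_num)] at h
  simp only [smul_eq_mul] at h
  linarith

theorem differentiableAt (hH : IsFinsler H) {a : E} (ha : a ≠ 0) : DifferentiableAt ℝ H a :=
  (hH.contDiffOn.differentiableOn one_ne_zero).differentiableAt (isOpen_compl_singleton.mem_nhds ha)

theorem abs_sub_le (hH : IsFinsler H) (x y : E) : |H x - H y| ≤ H (x - y) := by
  have h1 := hH.map_add_le (x - y) y
  have h2 := hH.map_add_le (y - x) x
  have h3 : H (y - x) = H (x - y) := by rw [← hH.map_neg, neg_sub]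
  rw [sub_add_cancel] at h1 h2
  rw [abs_le]
  constructor <;> linarith

theorem convexOn_rpow (hH : IsFinsler H) {p : ℝ} (hp : 1 ≤ p) :
    ConvexOn ℝ Set.univ (fun x => H x ^ p) := by
  refine ⟨convex_univ, fun x _ y _ a b ha hb hab => ?_⟩
  have h1 := hH.convex.2 (Set.mem_univ x) (Set.mem_univ y) ha hb hab
  have h2 := (_root_.convexOn_rpow hp).2 (Set.mem_Ici.2 (hH.nonneg x)) (Set.mem_Ici.2 (hH.nonneg y))
    ha hb hab
  exact (Real.rpow_le_rpow (hH.nonneg _) h1 (by linarith)).trans h2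

variable [FiniteDimensional ℝ E]

theorem continuous (hH : IsFinsler H) : Continuous H :=
  hH.convex.locallyLipschitz.continuous

theorem exists_bound (hH : IsFinsler H) : ∃ M : ℝ, 0 < M ∧ ∀ x, H x ≤ M * ‖x‖ := by
  obtain ⟨B, hB⟩ := (isCompact_sphere (0 : E) 1).bddAbove_image hH.continuous.continuousOn
  refine ⟨max B 1, by positivity, fun x => ?_⟩
  rcases eq_or_ne x 0 with rfl | hx
  · simp [hH.map_zero]
  have hx' : 0 < ‖x‖ := norm_pos_iff.2 hx
  have h1 : H (‖x‖⁻¹ • x) ≤ B := hB ⟨_, by simp [norm_smul, hx'.ne'], rfl⟩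
  have h2 : H x = ‖x‖ * H (‖x‖⁻¹ • x) := by
    rw [hH.homogeneous, abs_of_pos (inv_pos.2 hx'), mul_inv_cancel_left₀ hx'.ne']
  rw [h2, mul_comm]
  gcongr
  exact h1.trans (le_max_left _ _)

/-- `H` is `M`-Lipschitz by the reverse triangle inequality. The bound includes the origin, where
`gradient H` is only a default value. -/
theorem norm_gradient_le (hH : IsFinsler H) {M : ℝ} (hM : 0 ≤ M) (hb : ∀ x, H x ≤ M * ‖x‖) (a : E) :
    ‖gradient H a‖ ≤ M := by
  rw [gradient, LinearIsometryEquiv.norm_map]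
  have : LipschitzWith ⟨M, hM⟩ H := LipschitzWith.of_dist_le_mul fun x y => by
    rw [Real.dist_eq, dist_eq_norm]
    exact (hH.abs_sub_le x y).trans (hb _)
  exact norm_fderiv_le_of_lipschitz ℝ this

theorem hasDerivAt_line (hH : IsFinsler H) {a : E} (ha : a ≠ 0) (b : E) :
    HasDerivAt (fun t : ℝ => H (a + t • b)) (inner ℝ (gradient H a) b) 0 := by
  have h1 : HasDerivAt (fun t : ℝ => a + t • b) b 0 := by
    simpa using ((hasDerivAt_id (0 : ℝ)).smul_const b).const_add a
  have h2 : HasFDerivAt H (fderiv ℝ H a) (a + (0 : ℝ) • b) := by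
    simpa using (hH.differentiableAt ha).hasFDerivAt
  rw [inner_gradient_left]
  exact h2.comp_hasDerivAt (0 : ℝ) h1

/-- Euler's identity: along its own ray `H` is the linear function `(1 + t) * H a` for `t > -1`. -/
theorem inner_gradient_self (hH : IsFinsler H) {a : E} (ha : a ≠ 0) :
    inner ℝ (gradient H a) a = H a := by
  refine (hH.hasDerivAt_line ha a).unique ?_
  have h1 : HasDerivAt (fun t : ℝ => (1 + t) * H a) (H a) 0 := by
    simpa using ((hasDerivAt_id (0 : ℝ)).const_add 1).mul_const (H a)
  refine h1.congr_of_eventuallyEq ?_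
  filter_upwards [lt_mem_nhds (show (-1 : ℝ) < 0 by norm_num)] with t ht
  have : a + t • a = (1 + t) • a := by rw [add_smul, one_smul]
  rw [this, hH.homogeneous, abs_of_pos (by linarith)]

/-- Subadditivity bounds every right difference quotient of `H` at `a` in direction `b` by `H b`. -/
theorem inner_gradient_le (hH : IsFinsler H) {a : E} (ha : a ≠ 0) (b : E) :
    inner ℝ (gradient H a) b ≤ H b := by
  have h := (hH.hasDerivAt_line ha b).tendsto_slope_zero_right
  refine le_of_tendsto h ?_
  filter_upwards [self_mem_nhdsWithin] with t (ht : 0 < t)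
  have h1 := hH.map_add_le a (t • b)
  rw [hH.homogeneous, abs_of_pos ht] at h1
  simp only [zero_add, zero_smul, add_zero, smul_eq_mul]
  rw [inv_mul_le_iff₀ ht]
  linarith

/-- The subgradient inequality for `H ^ p / p`. -/
theorem rpow_mul_inner_gradient_sub_le (hH : IsFinsler H) {p : ℝ} (hp : 1 < p) (a b : E) :
    H a ^ (p - 1) * inner ℝ (gradient H a) b - H a ^ (p - 1) * inner ℝ (gradient H a) a ≤
      H b ^ p / p - H a ^ p / p := by
  have hp0 : 0 < p := by linarith
  rcases eq_or_ne a 0 with rfl | ha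
  -- At the origin the factor `0 ^ (p - 1) = 0` removes the default gradient; this needs `p > 1`.
  · rw [hH.map_zero, Real.zero_rpow (by linarith), Real.zero_rpow hp0.ne']
    have := Real.rpow_nonneg (hH.nonneg b) p
    simp only [zero_mul, sub_zero, zero_div]
    positivity
  have hA := hH.pos a ha
  have hpq := Real.HolderConjugate.conjExponent hp
  -- Young's inequality for `H b` and `H a ^ (p - 1)`; the conjugate power of the latter is again `H
  -- a ^ p`.
  have hy := Real.young_inequality_of_nonneg (hH.nonneg b)
    (Real.rpow_nonneg hA.le (p - 1)) hpq
  have h1 : (H a ^ (p - 1)) ^ p.conjExponent = H a ^ p := by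
    rw [← Real.rpow_mul hA.le]
    congr 1
    rw [Real.conjExponent]
    field_simp [show p - 1 ≠ 0 by linarith]
  have h2 : H a ^ (p - 1) * H a = H a ^ p := by
    rw [← Real.rpow_add_one hA.ne']; simp
  have h3 : H a ^ (p - 1) * inner ℝ (gradient H a) b ≤ H a ^ (p - 1) * H b := by
    gcongr
    exact hH.inner_gradient_le ha b
  have h4 : H a ^ p / p.conjExponent = H a ^ p - H a ^ p / p := by
    rw [Real.conjExponent]
    field_simp
  rw [hH.inner_gradient_self ha, h2]
  rw [h1, h4] at hy
  linarith

end IsFinsler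

end Finsler

/-! ### Pairs as points of the product space -/

section Embedding

variable {m k : ℕ}

/-- The linear isomorphism between pairs and points of `Space m k`. -/
def ofPair : (EuclideanSpace ℝ (Fin m) × EuclideanSpace ℝ (Fin k)) ≃L[ℝ] Space m k :=
  (WithLp.prodContinuousLinearEquiv 2 ℝ (EuclideanSpace ℝ (Fin m))
    (EuclideanSpace ℝ (Fin k))).symm

@[simp] theorem ofPair_fst (y : EuclideanSpace ℝ (Fin m) × EuclideanSpace ℝ (Fin k)) :
    (ofPair y).fst = y.1 := rfl

@[simp] theorem ofPair_snd (y : EuclideanSpace ℝ (Fin m) × EuclideanSpace ℝ (Fin k)) :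
    (ofPair y).snd = y.2 := rfl

theorem crossH_eq (H : Space m k → ℝ) (z : EuclideanSpace ℝ (Fin k)) :
    crossH H z = H (ofPair (0, z)) := rfl

theorem ofPair_eta (x : Space m k) : ofPair (x.fst, x.snd) = x := rfl

end Embedding

theorem IsFinsler.crossH {m k : ℕ} {H : Space m k → ℝ} (hH : IsFinsler H) :
    IsFinsler (crossH H) := by
  let L : EuclideanSpace ℝ (Fin k) →L[ℝ] Space m k :=
    ofPair.toContinuousLinearMap ∘L ContinuousLinearMap.inr ℝ _ _
  have hL : FinslerCylinder.crossH H = H ∘ L := rfl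
  have hz : ∀ z, z ≠ 0 → L z ≠ 0 := fun z hz h => hz (congrArg (fun x : Space m k => x.snd) h)
  rw [hL]
  refine ⟨fun z h => hH.pos _ (hz z h), hH.convex.comp_linearMap L.toLinearMap, fun t z => ?_, ?_⟩
  · simp only [Function.comp, map_smul, hH.homogeneous]
  · exact hH.contDiffOn.comp L.contDiff.contDiffOn fun z h => hz z h

/-! ### Convergence of integrals under `L ^ p` convergence -/

section Lebesgue

variable {α : Type*} [MeasurableSpace α] {μ : Measure α} {p : ℝ}

theorem one_le_ofReal (hp : 1 ≤ p) : (1 : ENNReal) ≤ ENNReal.ofReal p := by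
  simpa using ENNReal.ofReal_le_ofReal hp

theorem rpow_integral_eq_eLpNorm {F : Type*} [NormedAddCommGroup F] (hp : 1 ≤ p) {h : α → F}
    (hh : MemLp h (ENNReal.ofReal p) μ) :
    ∫ x, ‖h x‖ ^ p ∂μ = (eLpNorm h (ENNReal.ofReal p) μ).toReal ^ p := by
  have hp0 : 0 < p := by linarith
  have h0 : 0 ≤ ∫ x, ‖h x‖ ^ p ∂μ := integral_nonneg fun x => by positivity
  rw [hh.eLpNorm_eq_integral_rpow_norm (by simpa using hp0) ENNReal.ofReal_ne_top,
    ENNReal.toReal_ofReal hp0.le, ENNReal.toReal_ofReal (by positivity),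
    Real.rpow_inv_rpow h0 hp0.ne']

theorem tendsto_integral_norm_rpow {F : Type*} [NormedAddCommGroup F] (hp : 1 ≤ p)
    {h : ℕ → α → F} {h' : α → F}
    (hh : ∀ j, MemLp (h j) (ENNReal.ofReal p) μ) (hh' : MemLp h' (ENNReal.ofReal p) μ)
    (hlim : Tendsto (fun j => eLpNorm (fun x => h j x - h' x) (ENNReal.ofReal p) μ) atTop (𝓝 0)) :
    Tendsto (fun j => ∫ x, ‖h j x‖ ^ p ∂μ) atTop (𝓝 (∫ x, ‖h' x‖ ^ p ∂μ)) := by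
  have : Fact (1 ≤ ENNReal.ofReal p) := ⟨one_le_ofReal hp⟩
  have h1 := ((Lp.tendsto_Lp_iff_tendsto_eLpNorm'' h hh h' hh').2 hlim).norm
  simp only [Lp.norm_toLp] at h1
  simp only [rpow_integral_eq_eLpNorm hp hh', fun j => rpow_integral_eq_eLpNorm hp (hh j)]
  exact h1.rpow_const (Or.inr (by linarith))

theorem integrable_norm_rpow {F : Type*} [NormedAddCommGroup F] (hp : 1 ≤ p)
    {h : α → F} (hh : MemLp h (ENNReal.ofReal p) μ) : Integrable (fun x => ‖h x‖ ^ p) μ := by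
  have hp0 : 0 < p := by linarith
  have := hh.integrable_norm_rpow (by simpa using hp0) ENNReal.ofReal_ne_top
  rwa [ENNReal.toReal_ofReal hp0.le] at this

theorem integrable_mul_of_memLp (hp : 1 ≤ p) {g h : α → ℝ}
    (hg : MemLp g (ENNReal.conjExponent (ENNReal.ofReal p)) μ)
    (hh : MemLp h (ENNReal.ofReal p) μ) : Integrable (fun x => g x * h x) μ := by
  have : Fact (1 ≤ ENNReal.ofReal p) := ⟨one_le_ofReal hp⟩
  exact hg.integrable_mul hh

theorem tendsto_integral_mul (hp : 1 ≤ p) {g : α → ℝ}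
    (hg : MemLp g (ENNReal.conjExponent (ENNReal.ofReal p)) μ) {h : ℕ → α → ℝ} {h' : α → ℝ}
    (hh : ∀ j, MemLp (h j) (ENNReal.ofReal p) μ) (hh' : MemLp h' (ENNReal.ofReal p) μ)
    (hlim : Tendsto (fun j => eLpNorm (fun x => h j x - h' x) (ENNReal.ofReal p) μ) atTop (𝓝 0)) :
    Tendsto (fun j => ∫ x, g x * h j x ∂μ) atTop (𝓝 (∫ x, g x * h' x ∂μ)) := by
  have : Fact (1 ≤ ENNReal.ofReal p) := ⟨one_le_ofReal hp⟩
  refine tendsto_integral_of_L1' _ (integrable_mul_of_memLp hp hg hh').1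
    (Eventually.of_forall fun j => integrable_mul_of_memLp hp hg (hh j)) ?_
  have h1 : Tendsto (fun j => eLpNorm g (ENNReal.conjExponent (ENNReal.ofReal p)) μ *
      eLpNorm (fun x => h j x - h' x) (ENNReal.ofReal p) μ) atTop (𝓝 0) := by
    simpa using ENNReal.Tendsto.const_mul hlim (Or.inr hg.2.ne)
  refine tendsto_of_tendsto_of_tendsto_of_le_of_le tendsto_const_nhds h1 (fun _ => zero_le)
    fun j => ?_
  have h2 := eLpNorm_smul_le_mul_eLpNorm (p := ENNReal.conjExponent (ENNReal.ofReal p))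
    (q := ENNReal.ofReal p) (r := 1) ((hh j).sub hh').1 hg.1
  refine le_trans (le_of_eq ?_) h2
  refine congrArg (fun F => eLpNorm F 1 μ) (funext fun x => ?_)
  simp [mul_sub]

/-- A nonnegative quantity dominated by differences in `L ^ p` converges in `L ^ p`. -/
theorem tendsto_eLpNorm_zero_of_le {F : Type*} [NormedAddCommGroup F]
    {h : ℕ → α → F} {G : Type*} [NormedAddCommGroup G] {k : ℕ → α → G} {q : ENNReal} (M : ℝ)
    (hle : ∀ j x, ‖h j x‖ ≤ M * ‖k j x‖)
    (hlim : Tendsto (fun j => eLpNorm (k j) q μ) atTop (𝓝 0)) :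
    Tendsto (fun j => eLpNorm (h j) q μ) atTop (𝓝 0) := by
  have h1 : Tendsto (fun j => ENNReal.ofReal M * eLpNorm (k j) q μ) atTop (𝓝 0) := by
    simpa using ENNReal.Tendsto.const_mul hlim (Or.inr ENNReal.ofReal_ne_top)
  exact tendsto_of_tendsto_of_tendsto_of_le_of_le tendsto_const_nhds h1 (fun _ => zero_le)
    fun j => eLpNorm_le_mul_eLpNorm_of_ae_le_mul (Eventually.of_forall (hle j)) q

end Lebesgue

/-! ### Continuity of the energy; weak solutions are minimisers -/

section Energy

variable {E : Type*} [NormedAddCommGroup E] [InnerProductSpace ℝ E] [FiniteDimensional ℝ E]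
  {H : E → ℝ} {p : ℝ}

theorem IsFinsler.memLp_comp {α : Type*} [MeasurableSpace α] {μ : Measure α} (hH : IsFinsler H)
    {q : ENNReal} {G : α → E} (hG : MemLp G q μ) : MemLp (fun x => H (G x)) q μ := by
  obtain ⟨M, -, hb⟩ := hH.exists_bound
  refine hG.of_le_mul (c := M) (hH.continuous.comp_aestronglyMeasurable hG.1)
    (Eventually.of_forall fun x => ?_)
  rw [Real.norm_of_nonneg (hH.nonneg _)]
  exact hb _

theorem IsFinsler.integrable_rpow {α : Type*} [MeasurableSpace α] {μ : Measure α}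
    (hH : IsFinsler H) (hp : 1 ≤ p) {G : α → E} (hG : MemLp G (ENNReal.ofReal p) μ) :
    Integrable (fun x => H (G x) ^ p) μ := by
  refine (integrable_norm_rpow hp (hH.memLp_comp hG)).congr (Eventually.of_forall fun x => ?_)
  simp only [Real.norm_of_nonneg (hH.nonneg _)]

/-- `H` is Lipschitz and `g` lies in the dual exponent, so both terms pass to the limit. This
reduces the energy estimates to test functions. -/
theorem IsFinsler.tendsto_energy {α : Type*} [MeasurableSpace α] {μ : Measure α}
    (hH : IsFinsler H) (hp : 1 ≤ p) {g : α → ℝ}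
    (hg : MemLp g (ENNReal.conjExponent (ENNReal.ofReal p)) μ) {v : ℕ → α → ℝ} {v' : α → ℝ}
    {G : ℕ → α → E} {G' : α → E}
    (hv : ∀ j, MemLp (v j) (ENNReal.ofReal p) μ) (hv' : MemLp v' (ENNReal.ofReal p) μ)
    (hG : ∀ j, MemLp (G j) (ENNReal.ofReal p) μ) (hG' : MemLp G' (ENNReal.ofReal p) μ)
    (hvlim : Tendsto (fun j => eLpNorm (fun x => v j x - v' x) (ENNReal.ofReal p) μ) atTop (𝓝 0))
    (hGlim : Tendsto (fun j => eLpNorm (fun x => G j x - G' x) (ENNReal.ofReal p) μ) atTop (𝓝 0)) :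
    Tendsto (fun j => ∫ x, (H (G j x) ^ p / p - g x * v j x) ∂μ) atTop
      (𝓝 (∫ x, (H (G' x) ^ p / p - g x * v' x) ∂μ)) := by
  obtain ⟨M, -, hb⟩ := hH.exists_bound
  have h1 := tendsto_integral_norm_rpow hp (fun j => hH.memLp_comp (hG j)) (hH.memLp_comp hG')
    (tendsto_eLpNorm_zero_of_le M (fun j x => by
      rw [Real.norm_eq_abs]; exact (hH.abs_sub_le _ _).trans (hb _)) hGlim)
  have h2 := tendsto_integral_mul hp hg hv hv' hvlim
  simp only [Real.norm_of_nonneg (hH.nonneg _)] at h1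
  rw [integral_sub ((hH.integrable_rpow hp hG').div_const p) (integrable_mul_of_memLp hp hg hv'),
    integral_div]
  refine ((h1.div_const p).sub h2).congr fun j => ?_
  rw [integral_sub ((hH.integrable_rpow hp (hG j)).div_const p)
    (integrable_mul_of_memLp hp hg (hv j)), integral_div]

theorem IsFinsler.integrable_energy {α : Type*} [MeasurableSpace α] {μ : Measure α}
    (hH : IsFinsler H) (hp : 1 ≤ p) {g v : α → ℝ} {G : α → E}
    (hg : MemLp g (ENNReal.conjExponent (ENNReal.ofReal p)) μ)
    (hv : MemLp v (ENNReal.ofReal p) μ) (hG : MemLp G (ENNReal.ofReal p) μ) :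
    Integrable (fun x => H (G x) ^ p / p - g x * v x) μ :=
  ((hH.integrable_rpow hp hG).div_const p).sub (integrable_mul_of_memLp hp hg hv)

variable [MeasurableSpace E] [BorelSpace E]

theorem measurable_gradient (H : E → ℝ) : Measurable (gradient H) :=
  (InnerProductSpace.toDual ℝ E).symm.continuous.measurable.comp (measurable_fderiv ℝ H)

theorem IsFinsler.integrable_flux {α : Type*} [MeasurableSpace α] {μ : Measure α}
    (hH : IsFinsler H) (hp : 1 < p) {F G : α → E}
    (hF : MemLp F (ENNReal.ofReal p) μ) (hG : MemLp G (ENNReal.ofReal p) μ) :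
    Integrable (fun x => H (G x) ^ (p - 1) * inner ℝ (gradient H (G x)) (F x)) μ := by
  obtain ⟨M, hM, hb⟩ := hH.exists_bound
  refine Integrable.mono' (((hH.integrable_rpow hp.le hG).add
    (integrable_norm_rpow hp.le hF)).const_mul M) ?_ (Eventually.of_forall fun x => ?_)
  · refine AEStronglyMeasurable.mul ?_ (AEStronglyMeasurable.inner ?_ hF.1)
    · exact ((hH.continuous.rpow_const fun _ => Or.inr (by linarith)).comp_aestronglyMeasurable
        hG.1)
    · exact ((measurable_gradient H).comp_aemeasurable hG.1.aemeasurable).aestronglyMeasurable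
  · have h1 : |inner ℝ (gradient H (G x)) (F x)| ≤ M * ‖F x‖ :=
      (abs_real_inner_le_norm _ _).trans
        (mul_le_mul_of_nonneg_right (hH.norm_gradient_le hM.le hb _) (norm_nonneg _))
    have ha := hH.nonneg (G x)
    have hc := norm_nonneg (F x)
    -- Bounding both factors by their maximum gives `s ^ (p - 1) * t ≤ s ^ p + t ^ p` without
    -- Hölder's inequality.
    set m := max (H (G x)) ‖F x‖
    have hm : 0 ≤ m := ha.trans (le_max_left _ _)
    have h2 : H (G x) ^ (p - 1) * ‖F x‖ ≤ m ^ p := by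
      have h3 : m ^ p = m ^ (p - 1) * m := by
        rcases hm.eq_or_lt with h | h
        · rw [← h, Real.zero_rpow (by linarith), mul_zero]
        · rw [← Real.rpow_add_one h.ne']; simp
      rw [h3]
      exact mul_le_mul (Real.rpow_le_rpow ha (le_max_left _ _) (by linarith)) (le_max_right _ _) hc
        (Real.rpow_nonneg hm _)
    have h4 : m ^ p ≤ H (G x) ^ p + ‖F x‖ ^ p := by
      have := Real.rpow_nonneg ha p
      have := Real.rpow_nonneg hc p
      rcases max_choice (H (G x)) ‖F x‖ with h | h <;> simp only [m, h] <;> linarith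
    rw [Real.norm_eq_abs, abs_mul, abs_of_nonneg (Real.rpow_nonneg ha _)]
    calc H (G x) ^ (p - 1) * |inner ℝ (gradient H (G x)) (F x)|
        ≤ H (G x) ^ (p - 1) * (M * ‖F x‖) := by gcongr
      _ = M * (H (G x) ^ (p - 1) * ‖F x‖) := by ring
      _ ≤ M * (H (G x) ^ p + ‖F x‖ ^ p) := by gcongr; exact h2.trans h4

/-- Integrate the subgradient inequality at `∇u` in the direction of `∇v`. The equation is tested
with `v` and with `u` separately, so `v - u` need not be built as an element of `W10`. -/
theorem IsWeakSolution.isEnergyMinimizer (hH : IsFinsler H) (hp : 1 < p) {Ω : Set E} {g : E → ℝ}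
    (hg : MemLp g (ENNReal.conjExponent (ENNReal.ofReal p)) (volume.restrict Ω))
    {u : W10 p Ω} (hu : IsWeakSolution p Ω H g u) : IsEnergyMinimizer p Ω H g u := by
  intro v
  have hpos : 0 < p := by linarith
  have h1 := integral_mono ((hH.integrable_flux hp v.memLp_grad u.memLp_grad).sub
    (hH.integrable_flux hp u.memLp_grad u.memLp_grad))
    (((hH.integrable_rpow hp.le v.memLp_grad).div_const p).sub
    ((hH.integrable_rpow hp.le u.memLp_grad).div_const p))
    fun x => hH.rpow_mul_inner_gradient_sub_le hp (u.grad x) (v.grad x)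
  simp only [Pi.sub_apply] at h1
  rw [integral_sub (hH.integrable_flux hp v.memLp_grad u.memLp_grad)
    (hH.integrable_flux hp u.memLp_grad u.memLp_grad), hu v, hu u,
    integral_sub ((hH.integrable_rpow hp.le v.memLp_grad).div_const p)
    ((hH.integrable_rpow hp.le u.memLp_grad).div_const p)] at h1
  unfold energy
  rw [integral_sub ((hH.integrable_rpow hp.le u.memLp_grad).div_const p)
      (integrable_mul_of_memLp hp.le hg u.memLp_toFun),
    integral_sub ((hH.integrable_rpow hp.le v.memLp_grad).div_const p)
      (integrable_mul_of_memLp hp.le hg v.memLp_toFun)]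
  linarith

theorem IsSolution.isEnergyMinimizer (hH : IsFinsler H) (hp : 1 ≤ p) {Ω : Set E} {g : E → ℝ}
    (hg : MemLp g (ENNReal.conjExponent (ENNReal.ofReal p)) (volume.restrict Ω))
    {u : W10 p Ω} (hu : IsSolution p Ω H g u) : IsEnergyMinimizer p Ω H g u := by
  rcases hp.eq_or_lt with h | h
  · exact hu.2 h.symm
  · exact (hu.1 h).isEnergyMinimizer hH h hg

end Energy

/-! ### Test functions as Sobolev functions -/

section TestFunction

variable {E : Type*} [NormedAddCommGroup E] [InnerProductSpace ℝ E]
  {Ω : Set E} {φ : E → ℝ}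

theorem IsTestFunction.differentiable (h : IsTestFunction Ω φ) : Differentiable ℝ φ :=
  h.smooth.differentiable (by simp)

theorem IsTestFunction.eq_zero (h : IsTestFunction Ω φ) {x : E} (hx : x ∉ Ω) : φ x = 0 :=
  image_eq_zero_of_notMem_tsupport fun h' => hx (h.subset h')

theorem isTestFunction_zero (Ω : Set E) : IsTestFunction Ω (fun _ => 0) :=
  ⟨contDiff_const, HasCompactSupport.zero, by simp [tsupport]⟩

theorem IsTestFunction.memLp [MeasurableSpace E] [BorelSpace E] (h : IsTestFunction Ω φ)
    (q : ENNReal) (μ : Measure E) [IsFiniteMeasureOnCompacts μ] : MemLp φ q μ :=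
  h.smooth.continuous.memLp_of_hasCompactSupport h.compact

variable [FiniteDimensional ℝ E]

theorem IsTestFunction.continuous_gradient (h : IsTestFunction Ω φ) :
    Continuous (gradient φ) :=
  (InnerProductSpace.toDual ℝ E).symm.continuous.comp
    (h.smooth.continuous_fderiv (by simp))

theorem IsTestFunction.hasCompactSupport_gradient (h : IsTestFunction Ω φ) :
    HasCompactSupport (gradient φ) :=
  (h.compact.fderiv ℝ).comp_left (g := (InnerProductSpace.toDual ℝ E).symm)
    (LinearIsometryEquiv.map_zero _)

theorem IsTestFunction.gradient_eq_zero (h : IsTestFunction Ω φ) {x : E} (hx : x ∉ Ω) :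
    gradient φ x = 0 := by
  have : fderiv ℝ φ x = 0 := by
    by_contra h'
    exact hx (h.subset (support_fderiv_subset ℝ h'))
  rw [gradient, this, LinearIsometryEquiv.map_zero]

variable [MeasurableSpace E] [BorelSpace E]

theorem IsTestFunction.hasWeakGradient (h : IsTestFunction Ω φ) :
    HasWeakGradient Ω φ (gradient φ) := by
  intro ψ hψ
  rw [setIntegral_eq_integral_of_forall_compl_eq_zero fun x hx => by rw [h.eq_zero hx, zero_smul],
    setIntegral_eq_integral_of_forall_compl_eq_zero fun x hx => by rw [hψ.eq_zero hx, zero_smul]]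
  have i1 : Integrable (fun x => φ x • gradient ψ x) :=
    (h.smooth.continuous.smul hψ.continuous_gradient).integrable_of_hasCompactSupport
      h.compact.smul_right
  have i2 : Integrable (fun x => ψ x • gradient φ x) :=
    (hψ.smooth.continuous.smul h.continuous_gradient).integrable_of_hasCompactSupport
      hψ.compact.smul_right
  refine ext_inner_left ℝ fun v => ?_
  rw [inner_neg_right, ← integral_inner i1, ← integral_inner i2]
  have e1 : ∀ x, inner ℝ v (φ x • gradient ψ x) = φ x * fderiv ℝ ψ x v := fun x => by
    rw [inner_smul_right, real_inner_comm, inner_gradient_left]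
  have e2 : ∀ x, inner ℝ v (ψ x • gradient φ x) = fderiv ℝ φ x v * ψ x := fun x => by
    rw [inner_smul_right, real_inner_comm, inner_gradient_left, mul_comm]
  have j1 := i1.const_inner (𝕜 := ℝ) v
  have j2 := i2.const_inner (𝕜 := ℝ) v
  simp only [e1, e2] at j1 j2 ⊢
  exact integral_mul_fderiv_eq_neg_fderiv_mul_of_integrable j2 j1
    ((h.smooth.continuous.mul hψ.smooth.continuous).integrable_of_hasCompactSupport
      h.compact.mul_right) (fun x _ => h.differentiable x) (fun x _ => hψ.differentiable x)

theorem IsTestFunction.memLp_gradient (h : IsTestFunction Ω φ) (q : ENNReal) (μ : Measure E)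
    [IsFiniteMeasureOnCompacts μ] : MemLp (gradient φ) q μ :=
  h.continuous_gradient.memLp_of_hasCompactSupport h.hasCompactSupport_gradient

/-- A test function as an element of `W^{1,p}_0`. -/
def IsTestFunction.toW10 (h : IsTestFunction Ω φ) (p : ℝ) : W10 p Ω where
  toFun := φ
  grad := gradient φ
  memLp_toFun := h.memLp _ _
  memLp_grad := h.memLp_gradient _ _
  hasWeakGradient := h.hasWeakGradient
  mem_closure := ⟨fun _ => φ, fun _ => h, by simp, by simp⟩

end TestFunction

/-! ### Integrating out the first variable -/

section ParametricIntegral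

variable {X Y : Type*} [NormedAddCommGroup X] [NormedAddCommGroup Y]

theorem hasCompactSupport_slice {F : Type*} [Zero F] {V : X × Y → F} (hc : HasCompactSupport V)
    (z : Y) : HasCompactSupport fun y => V (y, z) := by
  refine HasCompactSupport.of_support_subset_isCompact (hc.isCompact.image continuous_fst)
    fun y hy => ⟨(y, z), subset_tsupport _ hy, rfl⟩

variable [NormedSpace ℝ X] [FiniteDimensional ℝ X]
  [MeasurableSpace X] [BorelSpace X] [NormedSpace ℝ Y]
  {μ : Measure X} [μ.IsAddHaarMeasure] {V : X × Y → ℝ}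

theorem contDiff_integral_fst (hV : ContDiff ℝ ∞ V) (hc : HasCompactSupport V) :
    ContDiff ℝ ∞ fun z => ∫ y, V (y, z) ∂μ := by
  have hk : IsCompact (Neg.neg '' (Prod.fst '' tsupport V)) :=
    (hc.isCompact.image continuous_fst).image continuous_neg
  -- The integral is the convolution of the constant `1` with `y ↦ V (-y, z)`, evaluated at `0`, so
  -- smoothness in `z` is that of a convolution with parameter.
  have h := contDiffOn_convolution_right_with_param_comp (μ := μ) (n := ⊤)
    (ContinuousLinearMap.mul ℝ ℝ) (v := fun _ : Y => (0 : X)) contDiffOn_const isOpen_univ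
    (f := fun _ : X => (1 : ℝ)) (g := fun z y => V (-y, z)) hk (fun z y _ hy => ?_)
    (locallyIntegrable_const 1) ?_
  · rw [contDiffOn_univ] at h
    convert h using 2 with z
    simp [convolution]
  · by_contra h'
    exact hy ⟨-y, ⟨(-y, z), subset_tsupport _ h', rfl⟩, neg_neg y⟩
  · exact (hV.comp (contDiff_snd.neg.prodMk contDiff_fst)).contDiffOn

theorem hasFDerivAt_integral_fst (hV : ContDiff ℝ ∞ V) (hc : HasCompactSupport V) (z : Y) :
    HasFDerivAt (fun z => ∫ y, V (y, z) ∂μ)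
      (∫ y, (fderiv ℝ V (y, z)).comp (ContinuousLinearMap.inr ℝ X Y) ∂μ) z := by
  have hd : Continuous (fderiv ℝ V) := hV.continuous_fderiv (by simp)
  obtain ⟨C, hC⟩ := hd.bounded_above_of_compact_support (hc.fderiv ℝ)
  have hK : IsCompact (Prod.fst '' tsupport V) := hc.isCompact.image continuous_fst
  have hcont : ∀ z, Continuous fun y => V (y, z) := fun z =>
    hV.continuous.comp (Continuous.prodMk_left z)
  have hcont' : ∀ z, Continuous fun y =>
      (fderiv ℝ V (y, z)).comp (ContinuousLinearMap.inr ℝ X Y) := fun z =>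
    (hd.comp (Continuous.prodMk_left z)).clm_comp continuous_const
  refine hasFDerivAt_integral_of_dominated_of_fderiv_le (s := Set.univ)
    (F' := fun z y => (fderiv ℝ V (y, z)).comp (ContinuousLinearMap.inr ℝ X Y))
    (bound := (Prod.fst '' tsupport V).indicator fun _ => C) univ_mem
    (Eventually.of_forall fun z => (hcont z).aestronglyMeasurable)
    ((hcont z).integrable_of_hasCompactSupport (hasCompactSupport_slice hc z))
    (hcont' z).aestronglyMeasurable (Eventually.of_forall fun y z _ => ?_) ?_
    (Eventually.of_forall fun y z _ => ?_)
  · by_cases hy : y ∈ Prod.fst '' tsupport V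
    · rw [Set.indicator_of_mem hy]
      refine (ContinuousLinearMap.opNorm_comp_le _ _).trans ?_
      refine (mul_le_mul (hC _) (ContinuousLinearMap.norm_inr_le_one ℝ X Y) (norm_nonneg _)
        ((norm_nonneg _).trans (hC (y, z)))).trans (mul_one C).le
    · rw [Set.indicator_of_notMem hy]
      have : fderiv ℝ V (y, z) = 0 := by
        by_contra h'
        exact hy ⟨(y, z), support_fderiv_subset ℝ h', rfl⟩
      simp [this]
  · exact (integrable_indicator_iff hK.measurableSet).2 (integrableOn_const hK.measure_lt_top.ne)
  · exact ((hV.differentiable (by simp)) (y, z)).hasFDerivAt.comp z (hasFDerivAt_prodMk_right y z)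

/-- Integration by parts against the constant `1`, on a slice of compact support. -/
theorem integral_fderiv_inl_eq_zero (hV : ContDiff ℝ ∞ V) (hc : HasCompactSupport V) (z : Y)
    (b : X) : ∫ y, fderiv ℝ V (y, z) (b, 0) ∂μ = 0 := by
  have hd : Continuous (fderiv ℝ V) := hV.continuous_fderiv (by simp)
  have hs : ∀ y, fderiv ℝ (fun y => V (y, z)) y b = fderiv ℝ V (y, z) (b, 0) := fun y => by
    have h' : HasFDerivAt (fun y => V (y, z)) _ y := HasFDerivAt.comp (g := V) (f := fun y => (y, z))
      y ((hV.differentiable (by simp)) (y, z)).hasFDerivAt (hasFDerivAt_prodMk_left y z)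
    rw [h'.fderiv]; simp
  have hi : Integrable (fun y => fderiv ℝ (fun y => V (y, z)) y b) μ := by
    simp only [hs]
    refine ((hd.comp (Continuous.prodMk_left z)).clm_apply
      continuous_const).integrable_of_hasCompactSupport ?_
    exact (hasCompactSupport_slice (hc.fderiv ℝ) z).comp_left
      (g := fun L : X × Y →L[ℝ] ℝ => L (b, 0)) rfl
  have hi' : Integrable (fun y => V (y, z)) μ := Continuous.integrable_of_hasCompactSupport
    (hV.continuous.comp (Continuous.prodMk_left z)) (hasCompactSupport_slice hc z)
  have h := integral_mul_fderiv_eq_neg_fderiv_mul_of_integrable (μ := μ) (v := b)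
    (f := fun _ : X => (1 : ℝ)) (g := fun y => V (y, z)) (by simp) (by simpa using hi)
    (by simpa using hi')
    (fun _ _ => differentiableAt_const _)
    (fun y _ => (hV.differentiable (by simp) (y, z)).comp (g := V) (f := fun y => (y, z)) y
      (hasFDerivAt_prodMk_left y z).differentiableAt)
  simpa [hs] using h

end ParametricIntegral

/-! ### Lower bound: slice averages and Jensen's inequality -/

section Cylinder

variable {m k : ℕ} {ω₁ : Set (EuclideanSpace ℝ (Fin m))} {ω₂ : Set (EuclideanSpace ℝ (Fin k))}
  {ℓ : ℝ}

theorem measurePreserving_ofPair (ω₁ : Set (EuclideanSpace ℝ (Fin m)))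
    (ω₂ : Set (EuclideanSpace ℝ (Fin k))) (ℓ : ℝ) :
    MeasurePreserving (ofPair (m := m) (k := k))
      ((volume.restrict (ℓ • ω₁)).prod (volume.restrict ω₂))
      (volume.restrict (cylinder ω₁ ω₂ ℓ)) := by
  have h : MeasurePreserving (ofPair (m := m) (k := k)) volume volume :=
    WithLp.volume_preserving_toLp _ _
  have h' := h.restrict_preimage_emb ofPair.toHomeomorph.measurableEmbedding (cylinder ω₁ ω₂ ℓ)
  rw [Measure.prod_restrict]
  exact h'

theorem integral_cylinder {F : Space m k → ℝ}
    (hF : Integrable F (volume.restrict (cylinder ω₁ ω₂ ℓ))) :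
    ∫ x in cylinder ω₁ ω₂ ℓ, F x = ∫ z in ω₂, ∫ y in ℓ • ω₁, F (ofPair (y, z)) := by
  have hmp := measurePreserving_ofPair ω₁ ω₂ ℓ
  rw [← hmp.integral_comp ofPair.toHomeomorph.measurableEmbedding]
  exact integral_prod_symm _ (hmp.integrable_comp_of_integrable hF)

theorem integrable_integral_cylinder {F : Space m k → ℝ}
    (hF : Integrable F (volume.restrict (cylinder ω₁ ω₂ ℓ))) :
    Integrable (fun z => ∫ y in ℓ • ω₁, F (ofPair (y, z))) (volume.restrict ω₂) :=
  ((measurePreserving_ofPair ω₁ ω₂ ℓ).integrable_comp_of_integrable hF).integral_prod_right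

theorem memLp_comp_snd {q : ENNReal} {f : EuclideanSpace ℝ (Fin k) → ℝ}
    (hf : MemLp f q (volume.restrict ω₂)) (hA : Bornology.IsBounded (ℓ • ω₁)) :
    MemLp (fun x : Space m k => f x.snd) q (volume.restrict (cylinder ω₁ ω₂ ℓ)) := by
  have : IsFiniteMeasure (volume.restrict (ℓ • ω₁)) :=
    isFiniteMeasure_restrict.2 hA.measure_lt_top.ne
  rw [← (measurePreserving_ofPair ω₁ ω₂ ℓ).map_eq]
  exact ofPair.toHomeomorph.measurableEmbedding.memLp_map_measure_iff.2 (hf.comp_snd _)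

theorem inner_space (x y : Space m k) :
    inner ℝ x y = inner ℝ x.fst y.fst + inner ℝ x.snd y.snd := WithLp.prod_inner_apply _ _

/-- The average over `ℓ ω₁` of the slices of `v`. -/
def sliceAverage (ω₁ : Set (EuclideanSpace ℝ (Fin m))) (ℓ : ℝ) (v : Space m k → ℝ)
    (z : EuclideanSpace ℝ (Fin k)) : ℝ :=
  (volume.real (ℓ • ω₁))⁻¹ * ∫ y, v (ofPair (y, z))

variable {v : Space m k → ℝ}

theorem IsTestFunction.contDiff_comp_ofPair {Ω : Set (Space m k)} (hv : IsTestFunction Ω v) :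
    ContDiff ℝ ∞ fun y => v (ofPair y) := hv.smooth.comp ofPair.contDiff

theorem IsTestFunction.hasCompactSupport_comp_ofPair {Ω : Set (Space m k)}
    (hv : IsTestFunction Ω v) : HasCompactSupport fun y => v (ofPair y) :=
  hv.compact.comp_homeomorph ofPair.toHomeomorph

theorem IsTestFunction.fderiv_comp_ofPair {Ω : Set (Space m k)} (hv : IsTestFunction Ω v)
    (y b : EuclideanSpace ℝ (Fin m) × EuclideanSpace ℝ (Fin k)) :
    fderiv ℝ (fun y => v (ofPair y)) y b = inner ℝ (gradient v (ofPair y)) (ofPair b) := by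
  have h := (hv.differentiable (ofPair y)).hasFDerivAt.comp y ofPair.hasFDerivAt
  have h' : HasFDerivAt (fun y => v (ofPair y)) _ y := h
  rw [h'.fderiv, inner_gradient_left]
  rfl

/-- The average is an integral over the whole of `ℝ^m`, hence smooth in `z`, and its support lies in
the projection of the compact support of `v`. -/
theorem IsTestFunction.sliceAverage (hv : IsTestFunction (cylinder ω₁ ω₂ ℓ) v) :
    IsTestFunction ω₂ (sliceAverage ω₁ ℓ v) := by
  have hsub : Function.support (FinslerCylinder.sliceAverage ω₁ ℓ v) ⊆
      (fun x : Space m k => x.snd) '' tsupport v := by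
    intro z hz
    by_contra h
    have : ∀ y, v (ofPair (y, z)) = 0 := fun y => by
      by_contra h'
      exact h ⟨_, subset_tsupport _ h', rfl⟩
    exact hz (by simp [FinslerCylinder.sliceAverage, this])
  have hK : IsCompact ((fun x : Space m k => x.snd) '' tsupport v) :=
    hv.compact.isCompact.image (WithLp.continuous_snd _ _ _)
  refine ⟨contDiff_const.mul
      (contDiff_integral_fst hv.contDiff_comp_ofPair hv.hasCompactSupport_comp_ofPair),
    HasCompactSupport.of_support_subset_isCompact hK hsub,
    (closure_minimal hsub hK.isClosed).trans ?_⟩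
  rintro _ ⟨x, hx, rfl⟩
  exact (hv.subset hx).2

theorem IsTestFunction.integrable_gradient_slice {Ω : Set (Space m k)} (hv : IsTestFunction Ω v)
    (z : EuclideanSpace ℝ (Fin k)) : Integrable fun y => gradient v (ofPair (y, z)) := by
  have h : HasCompactSupport fun y => gradient v (ofPair y) :=
    hv.hasCompactSupport_gradient.comp_homeomorph ofPair.toHomeomorph
  exact (hv.continuous_gradient.comp
    (ofPair.continuous.comp (Continuous.prodMk_left z))).integrable_of_hasCompactSupport
    (hasCompactSupport_slice h z)

/-- The derivatives along the slice integrate to zero; those across it come out of the integral. -/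
theorem IsTestFunction.integral_gradient_slice {Ω : Set (Space m k)} (hv : IsTestFunction Ω v)
    (z : EuclideanSpace ℝ (Fin k)) :
    ∫ y, gradient v (ofPair (y, z)) =
      ofPair (0, gradient (fun z => ∫ y, v (ofPair (y, z))) z) := by
  have hi := hv.integrable_gradient_slice z
  have hV := hv.contDiff_comp_ofPair
  have hc := hv.hasCompactSupport_comp_ofPair
  have hz := hasFDerivAt_integral_fst (μ := volume) hV hc z
  have key : ∀ y b, inner ℝ b (gradient v (ofPair (y, z))) =
      fderiv ℝ (fun y => v (ofPair y)) (y, z) (b.fst, b.snd) := fun y b => by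
    rw [hv.fderiv_comp_ofPair, real_inner_comm]
    rfl
  generalize hW : (fun y => v (ofPair y)) = V at *
  have hW' : (fun z => ∫ y, v (ofPair (y, z))) = fun z => ∫ y, V (y, z) := by rw [← hW]
  rw [hW'] at hz ⊢
  have hd : Continuous (fderiv ℝ V) := hV.continuous_fderiv (by simp)
  have hcomp : Integrable fun y => fderiv ℝ V (y, z) :=
    Continuous.integrable_of_hasCompactSupport (hd.comp (Continuous.prodMk_left z))
      (hasCompactSupport_slice (hc.fderiv ℝ) z)
  have hinr : Integrable fun y => (fderiv ℝ V (y, z)).comp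
      (ContinuousLinearMap.inr ℝ (EuclideanSpace ℝ (Fin m)) (EuclideanSpace ℝ (Fin k))) :=
    ((ContinuousLinearMap.compL ℝ (EuclideanSpace ℝ (Fin k))
      (EuclideanSpace ℝ (Fin m) × EuclideanSpace ℝ (Fin k)) ℝ).flip
      (ContinuousLinearMap.inr ℝ _ _)).integrable_comp hcomp
  refine ext_inner_left ℝ fun b => ?_
  have e : ∀ y, fderiv ℝ V (y, z) (b.fst, b.snd) =
      fderiv ℝ V (y, z) (b.fst, 0) + fderiv ℝ V (y, z) (0, b.snd) := fun y => by
    rw [← map_add, Prod.mk_add_mk, add_zero, zero_add]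
  rw [← integral_inner hi]
  simp only [key, e]
  rw [integral_add (hcomp.apply_continuousLinearMap _) (hcomp.apply_continuousLinearMap _),
    integral_fderiv_inl_eq_zero hV hc, zero_add, inner_space,
    ofPair_fst, ofPair_snd, inner_zero_right, zero_add, real_inner_comm, inner_gradient_left,
    hz.fderiv, ContinuousLinearMap.integral_apply hinr]
  rfl

/-- The vanishing first component is what makes `crossH H`, and no other restriction of `H`, appear
in the limit problem. -/
theorem gradient_sliceAverage (hv : IsTestFunction (cylinder ω₁ ω₂ ℓ) v)
    (z : EuclideanSpace ℝ (Fin k)) :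
    ofPair (0, gradient (sliceAverage ω₁ ℓ v) z) =
      ⨍ y in ℓ • ω₁, gradient v (ofPair (y, z)) := by
  have hd := (hasFDerivAt_integral_fst (μ := volume) hv.contDiff_comp_ofPair
    hv.hasCompactSupport_comp_ofPair z).differentiableAt
  have h1 : gradient (sliceAverage ω₁ ℓ v) z =
      (volume.real (ℓ • ω₁))⁻¹ • gradient (fun z => ∫ y, v (ofPair (y, z))) z := by
    unfold gradient
    rw [← map_smul, ← fderiv_const_mul hd]
    rfl
  have h2 : ∫ y in ℓ • ω₁, gradient v (ofPair (y, z)) = ∫ y, gradient v (ofPair (y, z)) :=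
    setIntegral_eq_integral_of_forall_compl_eq_zero fun y hy =>
      hv.gradient_eq_zero fun h => hy h.1
  rw [setAverage_eq, h2, hv.integral_gradient_slice, h1, ← map_smul, Prod.smul_mk, smul_zero]

theorem IsTestFunction.integrable_slice {Ω : Set (Space m k)} (hv : IsTestFunction Ω v)
    (z : EuclideanSpace ℝ (Fin k)) : Integrable fun y => v (ofPair (y, z)) :=
  (hv.contDiff_comp_ofPair.continuous.comp
    (Continuous.prodMk_left z)).integrable_of_hasCompactSupport
    (hasCompactSupport_slice hv.hasCompactSupport_comp_ofPair z)

theorem IsTestFunction.integrable_rpow_slice {Ω : Set (Space m k)} (hv : IsTestFunction Ω v)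
    {H : Space m k → ℝ} (hH : IsFinsler H) {p : ℝ} (hp : 1 ≤ p) (z : EuclideanSpace ℝ (Fin k)) :
    Integrable fun y => H (gradient v (ofPair (y, z))) ^ p := by
  have hc : Continuous fun x => H x ^ p := hH.continuous.rpow_const fun _ => Or.inr (by linarith)
  have hs : HasCompactSupport fun y => H (gradient v (ofPair y)) ^ p :=
    (hv.hasCompactSupport_gradient.comp_homeomorph ofPair.toHomeomorph).comp_left
      (g := fun x => H x ^ p) (by rw [hH.map_zero, Real.zero_rpow (by linarith)])
  exact (hc.comp (hv.continuous_gradient.comp (ofPair.continuous.comp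
    (Continuous.prodMk_left z)))).integrable_of_hasCompactSupport (hasCompactSupport_slice hs z)

theorem IsFinsler.crossH_sliceAverage_le {H : Space m k → ℝ} (hH : IsFinsler H) {p : ℝ}
    (hp : 1 ≤ p) (hA : Bornology.IsBounded (ℓ • ω₁)) (hA0 : volume (ℓ • ω₁) ≠ 0)
    (hv : IsTestFunction (cylinder ω₁ ω₂ ℓ) v) (z : EuclideanSpace ℝ (Fin k)) :
    FinslerCylinder.crossH H (gradient (FinslerCylinder.sliceAverage ω₁ ℓ v) z) ^ p ≤
      ⨍ y in ℓ • ω₁, H (gradient v (ofPair (y, z))) ^ p := by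
  have hc : Continuous fun x => H x ^ p := hH.continuous.rpow_const fun _ => Or.inr (by linarith)
  rw [crossH_eq, gradient_sliceAverage hv]
  exact (hH.convexOn_rpow hp).map_set_average_le hc.continuousOn isClosed_univ hA0
    hA.measure_lt_top.ne (Eventually.of_forall fun _ => Set.mem_univ _)
    (hv.integrable_gradient_slice z).integrableOn (hv.integrable_rpow_slice hH hp z).integrableOn

/-- By Fubini it is enough to compare on each slice: Jensen handles the gradient term, and `f z` is
constant on the slice, so the linear terms agree. -/
theorem energy_sliceAverage_le {H : Space m k → ℝ} (hH : IsFinsler H) {p : ℝ}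
    (hp : 1 ≤ p) (hA : Bornology.IsBounded (ℓ • ω₁)) (hA0 : volume (ℓ • ω₁) ≠ 0)
    {f : EuclideanSpace ℝ (Fin k) → ℝ}
    (hf : MemLp f (ENNReal.conjExponent (ENNReal.ofReal p)) (volume.restrict ω₂))
    (hv : IsTestFunction (cylinder ω₁ ω₂ ℓ) v) :
    volume.real (ℓ • ω₁) * energy p ω₂ (crossH H) f (hv.sliceAverage.toW10 p) ≤
      energy p (cylinder ω₁ ω₂ ℓ) H (fun x => f x.snd) (hv.toW10 p) := by
  have hc0 : 0 < volume.real (ℓ • ω₁) :=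
    ENNReal.toReal_pos hA0 hA.measure_lt_top.ne
  have hint := hH.integrable_energy hp (memLp_comp_snd hf hA) (hv.toW10 p).memLp_toFun
    (hv.toW10 p).memLp_grad
  have hint' := hH.crossH.integrable_energy hp hf (hv.sliceAverage.toW10 p).memLp_toFun
    (hv.sliceAverage.toW10 p).memLp_grad
  unfold energy
  rw [integral_cylinder hint, ← integral_const_mul]
  refine integral_mono (hint'.const_mul _) (integrable_integral_cylinder hint) fun z => ?_
  change volume.real (ℓ • ω₁) * (crossH H (gradient (sliceAverage ω₁ ℓ v) z) ^ p / p -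
    f z * sliceAverage ω₁ ℓ v z) ≤
    ∫ y in ℓ • ω₁, (H (gradient v (ofPair (y, z))) ^ p / p - f z * v (ofPair (y, z)))
  have i1 := hv.integrable_rpow_slice hH hp z
  have i2 := hv.integrable_slice z
  have h1 := hH.crossH_sliceAverage_le hp hA hA0 hv z
  have h3 : ∫ y in ℓ • ω₁, v (ofPair (y, z)) = ∫ y, v (ofPair (y, z)) :=
    setIntegral_eq_integral_of_forall_compl_eq_zero fun y hy => hv.eq_zero fun h => hy h.1
  rw [integral_sub (i1.integrableOn.div_const p) (i2.integrableOn.const_mul _), integral_div,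
    integral_const_mul, h3]
  rw [setAverage_eq, smul_eq_mul, ← div_eq_inv_mul, le_div_iff₀ hc0] at h1
  have h2 : volume.real (ℓ • ω₁) * sliceAverage ω₁ ℓ v z = ∫ y, v (ofPair (y, z)) := by
    rw [sliceAverage, mul_inv_cancel_left₀ hc0.ne']
  rw [mul_sub, mul_left_comm, h2, mul_div_assoc']
  gcongr
  linarith

/-- The lower bound for the energy on the cylinder. -/
theorem IsEnergyMinimizer.mul_energy_le {H : Space m k → ℝ} (hH : IsFinsler H) {p : ℝ}
    (hp : 1 ≤ p) (hA : Bornology.IsBounded (ℓ • ω₁)) (hA0 : volume (ℓ • ω₁) ≠ 0)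
    {f : EuclideanSpace ℝ (Fin k) → ℝ}
    (hf : MemLp f (ENNReal.conjExponent (ENNReal.ofReal p)) (volume.restrict ω₂))
    {w : W10 p ω₂} (hw : IsEnergyMinimizer p ω₂ (crossH H) f w)
    (u : W10 p (cylinder ω₁ ω₂ ℓ)) :
    volume.real (ℓ • ω₁) * energy p ω₂ (crossH H) f w ≤
      energy p (cylinder ω₁ ω₂ ℓ) H (fun x => f x.snd) u := by
  obtain ⟨φ, hφ, h1, h2⟩ := u.mem_closure
  have hlim := hH.tendsto_energy hp (memLp_comp_snd hf hA) (fun j => (hφ j).memLp _ _)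
    u.memLp_toFun (fun j => (hφ j).memLp_gradient _ _) u.memLp_grad h1 h2
  refine ge_of_tendsto' hlim fun j => ?_
  exact (mul_le_mul_of_nonneg_left (hw _) measureReal_nonneg).trans
    (energy_sliceAverage_le hH hp hA hA0 hf (hφ j))

end Cylinder

/-! ### Cutoffs with a uniform gradient bound -/

section Cutoff

variable {X : Type*} [NormedAddCommGroup X] [InnerProductSpace ℝ X]

/-- Convexity gives `ℓ U = (ℓ - 1) U + U`, and `U` contains the ball of radius `r`. Thus the layer
has width at least `r` for every `ℓ`. -/
theorem thickening_smul_subset {U : Set X} (hU : Convex ℝ U) {r : ℝ}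
    (hr : Metric.ball 0 r ⊆ U) {ℓ : ℝ} (hℓ : 1 ≤ ℓ) :
    Metric.thickening r ((ℓ - 1) • U) ⊆ ℓ • U := by
  intro x hx
  obtain ⟨y, hy, hxy⟩ := Metric.mem_thickening_iff.1 hx
  have h := hU.add_smul (sub_nonneg.2 hℓ) zero_le_one
  rw [sub_add_cancel, one_smul] at h
  rw [h]
  exact ⟨y, hy, x - y, hr (by rwa [mem_ball_zero_iff, ← dist_eq_norm]), add_sub_cancel _ _⟩

variable [FiniteDimensional ℝ X] [MeasurableSpace X] [BorelSpace X]

/-- Mollified indicators: a smooth cutoff that is `1` on `S`, lives in the open `r`-neighbourhood of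
`S`, and has a gradient bound that depends on `r` only. -/
theorem exists_cutoff {r : ℝ} (hr : 0 < r) : ∃ R : ℝ, 0 ≤ R ∧ ∀ S : Set X, Bornology.IsBounded S →
    ∃ ρ : X → ℝ, IsTestFunction (Metric.thickening r S) ρ ∧ (∀ y, 0 ≤ ρ y) ∧ (∀ y, ρ y ≤ 1) ∧
      (∀ y ∈ S, ρ y = 1) ∧ ∀ y, ‖gradient ρ y‖ ≤ R := by
  -- The kernel has radius `r / 3` and is convolved with the indicator of the `r / 3`-thickening of
  -- `S`: the result is `1` on `S` and is supported within distance `2 r / 3 < r`.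
  let b : ContDiffBump (0 : X) := ⟨r / 6, r / 3, by positivity, by linarith⟩
  let ψ : X → ℝ := b.normed volume
  have hψc : HasCompactSupport ψ := b.hasCompactSupport_normed
  have hψs : ContDiff ℝ ∞ ψ := b.contDiff_normed
  have hψd : Continuous (fderiv ℝ ψ) := hψs.continuous_fderiv (by simp)
  have hψ0 : ∀ x, r / 3 ≤ ‖x‖ → ψ x = 0 := fun x hx => by
    by_contra h
    have : x ∈ Function.support ψ := h
    rw [b.support_normed_eq, mem_ball_zero_iff] at this
    exact absurd this (not_lt.2 hx)
  have hψi : Integrable ψ := hψs.continuous.integrable_of_hasCompactSupport hψc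
  have hψ'i : Integrable fun x => ‖fderiv ℝ ψ x‖ :=
    (hψd.integrable_of_hasCompactSupport (hψc.fderiv ℝ)).norm
  -- The derivative falls on the kernel and the indicator is at most `1`, so the `L¹` norm of the
  -- kernel's derivative serves for every `S`.
  refine ⟨∫ x, ‖fderiv ℝ ψ x‖, integral_nonneg fun _ => norm_nonneg _, fun S hS => ?_⟩
  let A := Metric.thickening (r / 3) S
  have hA : MeasurableSet A := Metric.isOpen_thickening.measurableSet
  let χ : X → ℝ := A.indicator fun _ => 1
  have hχ : LocallyIntegrable χ := (locallyIntegrable_const 1).indicator hA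
  have hχ0 : ∀ x, 0 ≤ χ x := fun x => Set.indicator_nonneg (fun _ _ => zero_le_one) x
  have hχ1 : ∀ x, χ x ≤ 1 := fun x => Set.indicator_le' (fun _ _ => le_rfl)
    (fun _ _ => zero_le_one) x
  let ρ : X → ℝ := convolution χ ψ (ContinuousLinearMap.mul ℝ ℝ) volume
  have hρ : ∀ x, ρ x = ∫ t, χ t * ψ (x - t) := fun x => rfl
  have hshift : ∀ x, Integrable fun t => ψ (x - t) := fun x => hψi.comp_sub_left x
  have hint1 : ∀ x, ∫ t, ψ (x - t) = 1 := fun x => by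
    rw [integral_sub_left_eq_self ψ volume x, b.integral_normed]
  have hint : ∀ x, Integrable fun t => χ t * ψ (x - t) := fun x =>
    (hshift x).bdd_mul (c := 1) hχ.aestronglyMeasurable
      (Eventually.of_forall fun t => by rw [Real.norm_of_nonneg (hχ0 t)]; exact hχ1 t)
  have hsupp : Function.support ρ ⊆ Metric.cthickening (r / 3 + r / 3) S := by
    intro x hx
    by_contra h
    refine hx ((hρ x).trans ?_)
    rw [← integral_zero X ℝ (μ := volume)]
    refine integral_congr_ae (Eventually.of_forall fun t => ?_)
    by_cases ht : t ∈ A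
    · have : ψ (x - t) = 0 := hψ0 _ <| by
        by_contra! h'
        refine h (Metric.thickening_subset_cthickening _ _
          (Metric.thickening_thickening_subset _ _ S ?_))
        exact Metric.mem_thickening_iff.2 ⟨t, ht, by rwa [dist_eq_norm]⟩
      simp [this]
    · simp [χ, ht]
  have hsub : tsupport ρ ⊆ Metric.cthickening (r / 3 + r / 3) S :=
    closure_minimal hsupp Metric.isClosed_cthickening
  refine ⟨ρ, ⟨hψc.contDiff_convolution_right _ hχ hψs, ?_, ?_⟩, fun x => ?_, fun x => ?_,
    fun x hx => ?_, fun x => ?_⟩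
  · exact HasCompactSupport.of_support_subset_isCompact
      (Metric.isCompact_of_isClosed_isBounded Metric.isClosed_cthickening hS.cthickening) hsupp
  · exact hsub.trans (Metric.cthickening_subset_thickening' hr (by linarith) S)
  · exact integral_nonneg fun t => mul_nonneg (hχ0 t) (b.nonneg_normed _)
  · rw [hρ, ← hint1 x]
    exact integral_mono (hint x) (hshift x) fun t =>
      mul_le_of_le_one_left (b.nonneg_normed _) (hχ1 t)
  · rw [hρ, ← hint1 x]
    refine integral_congr_ae (Eventually.of_forall fun t => ?_)
    by_cases ht : t ∈ A
    · simp [χ, ht]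
    · have : ψ (x - t) = 0 := hψ0 _ <| by
        by_contra! h'
        exact ht (Metric.mem_thickening_iff.2 ⟨x, hx, by rwa [dist_comm, dist_eq_norm]⟩)
      simp [this]
  · have hd := hψc.hasFDerivAt_convolution_right (ContinuousLinearMap.mul ℝ ℝ) hχ
      (hψs.of_le (by simp)) x
    have hd' : fderiv ℝ ρ x = _ := hd.fderiv
    rw [gradient, LinearIsometryEquiv.norm_map, hd', ← integral_sub_left_eq_self _ volume x]
    refine norm_integral_le_of_norm_le (hψ'i.comp_sub_left x) (Eventually.of_forall fun t => ?_)
    have : (ContinuousLinearMap.precompR X (ContinuousLinearMap.mul ℝ ℝ)) (χ t)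
        (fderiv ℝ ψ (x - t)) = χ t • fderiv ℝ ψ (x - t) := by
      ext; simp [ContinuousLinearMap.precompR_apply]
    rw [this, norm_smul, Real.norm_of_nonneg (hχ0 t)]
    exact mul_le_of_le_one_left (norm_nonneg _) (hχ1 t)

end Cutoff

/-! ### Upper bound: products of a cutoff with a cross-section function -/

section UpperBound

variable {m k : ℕ} {ω₁ : Set (EuclideanSpace ℝ (Fin m))} {ω₂ : Set (EuclideanSpace ℝ (Fin k))}
  {ℓ : ℝ} {ρ : EuclideanSpace ℝ (Fin m) → ℝ} {φ : EuclideanSpace ℝ (Fin k) → ℝ}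

theorem IsTestFunction.mul_cylinder (hρ : IsTestFunction (ℓ • ω₁) ρ) (hφ : IsTestFunction ω₂ φ) :
    IsTestFunction (cylinder ω₁ ω₂ ℓ) fun x : Space m k => ρ x.fst * φ x.snd := by
  have hK : IsCompact (ofPair (m := m) (k := k) '' (tsupport ρ ×ˢ tsupport φ)) :=
    (hρ.compact.isCompact.prod hφ.compact.isCompact).image ofPair.continuous
  have hsub : Function.support (fun x : Space m k => ρ x.fst * φ x.snd) ⊆
      ofPair '' (tsupport ρ ×ˢ tsupport φ) := fun x hx =>
    ⟨(x.fst, x.snd), ⟨subset_tsupport _ (left_ne_zero_of_mul hx),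
      subset_tsupport _ (right_ne_zero_of_mul hx)⟩, rfl⟩
  have h1 : ContDiff ℝ ∞ fun x : Space m k => (ofPair.symm x).1 :=
    contDiff_fst.comp ofPair.symm.contDiff
  have h2 : ContDiff ℝ ∞ fun x : Space m k => (ofPair.symm x).2 :=
    contDiff_snd.comp ofPair.symm.contDiff
  refine ⟨(hρ.smooth.comp h1).mul (hφ.smooth.comp h2),
    HasCompactSupport.of_support_subset_isCompact hK hsub,
    (closure_minimal hsub hK.isClosed).trans ?_⟩
  rintro _ ⟨y, hy, rfl⟩
  exact ⟨hρ.subset hy.1, hφ.subset hy.2⟩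

theorem IsTestFunction.gradient_mul_cylinder (hρ : IsTestFunction (ℓ • ω₁) ρ)
    (hφ : IsTestFunction ω₂ φ) (y : EuclideanSpace ℝ (Fin m)) (z : EuclideanSpace ℝ (Fin k)) :
    gradient (fun x : Space m k => ρ x.fst * φ x.snd) (ofPair (y, z)) =
      ofPair (φ z • gradient ρ y, ρ y • gradient φ z) := by
  refine ext_inner_right ℝ fun b => ?_
  have h := (hρ.mul_cylinder hφ).fderiv_comp_ofPair (y, z) (b.fst, b.snd)
  have h1 : HasFDerivAt (fun q : EuclideanSpace ℝ (Fin m) × EuclideanSpace ℝ (Fin k) => ρ q.1)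
      _ (y, z) := HasFDerivAt.comp (g := ρ) (y, z) (hρ.differentiable y).hasFDerivAt hasFDerivAt_fst
  have h2 : HasFDerivAt (fun q : EuclideanSpace ℝ (Fin m) × EuclideanSpace ℝ (Fin k) => φ q.2)
      _ (y, z) := HasFDerivAt.comp (g := φ) (y, z) (hφ.differentiable z).hasFDerivAt hasFDerivAt_snd
  rw [ofPair_eta] at h
  rw [← h, inner_space]
  have h3 := (h1.mul h2).fderiv
  simp only [ofPair_fst, ofPair_snd, inner_smul_left, inner_gradient_left]
  refine (congrArg (fun L => L (b.fst, b.snd)) h3).trans ?_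
  simp
  ring

theorem norm_ofPair_inl (y : EuclideanSpace ℝ (Fin m)) :
    ‖(ofPair (y, 0) : Space m k)‖ = ‖y‖ := WithLp.norm_toLp_fst 2 _ _ y

theorem norm_ofPair_inr (z : EuclideanSpace ℝ (Fin k)) :
    ‖(ofPair (0, z) : Space m k)‖ = ‖z‖ := WithLp.norm_toLp_snd 2 _ _ z

/-- Applied with `y = ∇ρ`, `t = ρ`, `s = φ` and `z = ∇φ`, it controls the gradient of `ρ φ` in the
layer where `ρ` varies. -/
theorem IsFinsler.map_ofPair_rpow_le {H : Space m k → ℝ} (hH : IsFinsler H) {M R p : ℝ}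
    (hM : 0 ≤ M) (hb : ∀ x, H x ≤ M * ‖x‖) (hR : 0 ≤ R) (hp : 1 ≤ p)
    {y : EuclideanSpace ℝ (Fin m)} (hy : ‖y‖ ≤ R) {t : ℝ} (ht0 : 0 ≤ t) (ht1 : t ≤ 1) (s : ℝ)
    (z : EuclideanSpace ℝ (Fin k)) :
    H (ofPair (s • y, t • z)) ^ p ≤ (M * (R + 1)) ^ p * (‖s‖ ^ p + ‖z‖ ^ p) := by
  have h1 : H (ofPair (s • y, t • z)) ≤ M * (R * ‖s‖ + ‖z‖) := by
    have e : (ofPair (s • y, t • z) : Space m k) = ofPair (s • y, 0) + ofPair (0, t • z) := by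
      rw [← map_add, Prod.mk_add_mk, add_zero, zero_add]
    rw [e]
    refine (hb _).trans (mul_le_mul_of_nonneg_left ((norm_add_le _ _).trans ?_) hM)
    rw [norm_ofPair_inl, norm_ofPair_inr, norm_smul, norm_smul, Real.norm_of_nonneg ht0,
      mul_comm ‖s‖]
    have := mul_le_mul_of_nonneg_right hy (norm_nonneg s)
    have := mul_le_of_le_one_left (norm_nonneg z) ht1
    linarith
  set q := max ‖s‖ ‖z‖
  have hq : 0 ≤ q := (norm_nonneg s).trans (le_max_left _ _)
  have h2 : H (ofPair (s • y, t • z)) ≤ M * (R + 1) * q := by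
    refine h1.trans ?_
    rw [mul_assoc, add_mul, one_mul]
    gcongr
    · exact le_max_left _ _
    · exact le_max_right _ _
  have h3 : q ^ p ≤ ‖s‖ ^ p + ‖z‖ ^ p := by
    have := Real.rpow_nonneg (norm_nonneg s) p
    have := Real.rpow_nonneg (norm_nonneg z) p
    rcases max_choice ‖s‖ ‖z‖ with h | h <;> simp only [q, h] <;> linarith
  refine (Real.rpow_le_rpow (hH.nonneg _) h2 (by linarith)).trans ?_
  rw [Real.mul_rpow (by positivity) hq]
  gcongr

/-- A bound for the energy per unit length of the product of `w` with a cutoff. -/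
def layerBound (p K : ℝ) (f : EuclideanSpace ℝ (Fin k) → ℝ) (w : W10 p ω₂) : ℝ :=
  ∫ z in ω₂, (K * (‖w.toFun z‖ ^ p + ‖w.grad z‖ ^ p) + ‖f z‖ * ‖w.toFun z‖)

variable {p : ℝ} {f : EuclideanSpace ℝ (Fin k) → ℝ}

theorem integrable_layerBound (hp : 1 ≤ p) (K : ℝ)
    (hf : MemLp f (ENNReal.conjExponent (ENNReal.ofReal p)) (volume.restrict ω₂)) (w : W10 p ω₂) :
    Integrable (fun z => K * (‖w.toFun z‖ ^ p + ‖w.grad z‖ ^ p) + ‖f z‖ * ‖w.toFun z‖)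
      (volume.restrict ω₂) :=
  (((integrable_norm_rpow hp w.memLp_toFun).add (integrable_norm_rpow hp w.memLp_grad)).const_mul
    K).add (integrable_mul_of_memLp hp hf.norm w.memLp_toFun.norm)

theorem layerBound_eq (hp : 1 ≤ p) (K : ℝ)
    (hf : MemLp f (ENNReal.conjExponent (ENNReal.ofReal p)) (volume.restrict ω₂)) (w : W10 p ω₂) :
    layerBound p K f w = K * ((∫ z in ω₂, ‖w.toFun z‖ ^ p) + ∫ z in ω₂, ‖w.grad z‖ ^ p) +
      ∫ z in ω₂, ‖f z‖ * ‖w.toFun z‖ := by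
  have i1 := integrable_norm_rpow hp w.memLp_toFun
  have i2 := integrable_norm_rpow hp w.memLp_grad
  have i3 : Integrable (fun z => K * (‖w.toFun z‖ ^ p + ‖w.grad z‖ ^ p)) (volume.restrict ω₂) :=
    (i1.add i2).const_mul K
  rw [layerBound, integral_add i3 (integrable_mul_of_memLp hp hf.norm w.memLp_toFun.norm),
    integral_const_mul, integral_add i1 i2]

theorem tendsto_layerBound (hp : 1 ≤ p) (K : ℝ)
    (hf : MemLp f (ENNReal.conjExponent (ENNReal.ofReal p)) (volume.restrict ω₂)) (w : W10 p ω₂)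
    {φ : ℕ → EuclideanSpace ℝ (Fin k) → ℝ} (hφ : ∀ j, IsTestFunction ω₂ (φ j))
    (h1 : Tendsto (fun j => eLpNorm (fun x => φ j x - w.toFun x) (ENNReal.ofReal p)
      (volume.restrict ω₂)) atTop (𝓝 0))
    (h2 : Tendsto (fun j => eLpNorm (fun x => gradient (φ j) x - w.grad x) (ENNReal.ofReal p)
      (volume.restrict ω₂)) atTop (𝓝 0)) :
    Tendsto (fun j => layerBound p K f ((hφ j).toW10 p)) atTop (𝓝 (layerBound p K f w)) := by
  rw [layerBound_eq hp K hf]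
  simp only [fun j => layerBound_eq hp K hf ((hφ j).toW10 p)]
  have hm : ∀ j, MemLp (φ j) (ENNReal.ofReal p) (volume.restrict ω₂) := fun j => (hφ j).memLp _ _
  refine (((tendsto_integral_norm_rpow hp hm w.memLp_toFun h1).add
    (tendsto_integral_norm_rpow hp (fun j => (hφ j).memLp_gradient _ _) w.memLp_grad h2)).const_mul
    K).add (tendsto_integral_mul hp hf.norm (fun j => (hm j).norm) w.memLp_toFun.norm
      (tendsto_eLpNorm_zero_of_le 1 (fun j x => ?_) h1))
  rw [one_mul]
  exact abs_norm_sub_norm_le _ _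

/-- Each slice splits into `S`, where the energy density is exactly that of `φ`, and the rest, where
it is bounded by the integrand of `layerBound`. -/
theorem energy_mul_cylinder_le {H : Space m k → ℝ} (hH : IsFinsler H) {M R : ℝ}
    (hM : 0 ≤ M) (hb : ∀ x, H x ≤ M * ‖x‖) (hR : 0 ≤ R) (hp : 1 ≤ p)
    (hA : Bornology.IsBounded (ℓ • ω₁)) (hAo : IsOpen (ℓ • ω₁))
    {S : Set (EuclideanSpace ℝ (Fin m))} (hS : IsOpen S) (hSA : S ⊆ ℓ • ω₁)
    (hf : MemLp f (ENNReal.conjExponent (ENNReal.ofReal p)) (volume.restrict ω₂))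
    (hρ : IsTestFunction (ℓ • ω₁) ρ) (hρ0 : ∀ y, 0 ≤ ρ y) (hρ1 : ∀ y, ρ y ≤ 1)
    (hρS : ∀ y ∈ S, ρ y = 1) (hρR : ∀ y, ‖gradient ρ y‖ ≤ R) (hφ : IsTestFunction ω₂ φ) :
    energy p (cylinder ω₁ ω₂ ℓ) H (fun x => f x.snd) ((hρ.mul_cylinder hφ).toW10 p) ≤
      volume.real S * energy p ω₂ (crossH H) f (hφ.toW10 p) +
      (volume.real (ℓ • ω₁) - volume.real S) *
        layerBound p ((M * (R + 1)) ^ p / p) f (hφ.toW10 p) := by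
  have hv := hρ.mul_cylinder hφ
  have hAt : volume (ℓ • ω₁) ≠ ⊤ := hA.measure_lt_top.ne
  have hint := hH.integrable_energy hp (memLp_comp_snd hf hA) (hv.toW10 p).memLp_toFun
    (hv.toW10 p).memLp_grad
  have hint' := hH.crossH.integrable_energy hp hf (hφ.toW10 p).memLp_toFun
    (hφ.toW10 p).memLp_grad
  have hintB := integrable_layerBound hp ((M * (R + 1)) ^ p / p) hf (hφ.toW10 p)
  unfold energy layerBound
  rw [integral_cylinder hint, ← integral_const_mul, ← integral_const_mul,
    ← integral_add (hint'.const_mul _) (hintB.const_mul _)]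
  refine integral_mono (integrable_integral_cylinder hint)
    ((hint'.const_mul _).add (hintB.const_mul _)) fun z => ?_
  have hi : Integrable fun y => H (gradient (fun x : Space m k => ρ x.fst * φ x.snd)
      (ofPair (y, z))) ^ p / p - f z * (ρ y * φ z) :=
    ((hv.integrable_rpow_slice hH hp z).div_const p).sub ((hv.integrable_slice z).const_mul (f z))
  change ∫ y in ℓ • ω₁, (H (gradient (fun x : Space m k => ρ x.fst * φ x.snd)
      (ofPair (y, z))) ^ p / p - f z * (ρ y * φ z)) ≤
    volume.real S * (crossH H (gradient φ z) ^ p / p - f z * φ z) +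
    (volume.real (ℓ • ω₁) - volume.real S) * ((M * (R + 1)) ^ p / p *
      (‖φ z‖ ^ p + ‖gradient φ z‖ ^ p) + ‖f z‖ * ‖φ z‖)
  simp only [hρ.gradient_mul_cylinder hφ] at hi ⊢
  rw [← Set.union_sdiff_cancel hSA, setIntegral_union Set.disjoint_sdiff_right
    (hAo.measurableSet.diff hS.measurableSet) hi.integrableOn hi.integrableOn,
    Set.union_sdiff_cancel hSA]
  refine add_le_add (le_of_eq ?_) ?_
  · rw [setIntegral_congr_fun (g := fun _ => crossH H (gradient φ z) ^ p / p - f z * φ z)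
      hS.measurableSet fun y hy => ?_, setIntegral_const, smul_eq_mul]
    -- Since `S` is open, `ρ` is constant near each of its points.
    have hg : gradient ρ y = 0 := by
      have : ρ =ᶠ[𝓝 y] fun _ => 1 := by
        filter_upwards [hS.mem_nhds hy] with t ht using hρS t ht
      rw [this.gradient_eq, gradient_fun_const]
    simp only [hg, hρS y hy, smul_zero, one_smul, one_mul, crossH_eq]
  · rw [← measureReal_sdiff hSA hS.measurableSet hAt, ← smul_eq_mul, ← setIntegral_const]
    refine setIntegral_mono_on hi.integrableOn (integrableOn_const
      (measure_ne_top_of_subset Set.sdiff_subset hAt)) (hAo.measurableSet.diff hS.measurableSet) fun y _ => ?_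
    have h1 := hH.map_ofPair_rpow_le hM hb hR hp (hρR y) (hρ0 y) (hρ1 y) (φ z) (gradient φ z)
    have h2 : -(f z * (ρ y * φ z)) ≤ ‖f z‖ * ‖φ z‖ := by
      refine (neg_le_abs _).trans ?_
      rw [abs_mul, abs_mul, abs_of_nonneg (hρ0 y), Real.norm_eq_abs, Real.norm_eq_abs]
      gcongr
      exact mul_le_of_le_one_left (abs_nonneg _) (hρ1 y)
    have h3 := div_le_div_of_nonneg_right h1 (show 0 ≤ p by linarith)
    rw [mul_div_right_comm] at h3
    linarith

/-- The upper bound for the energy on the cylinder, before normalization. -/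
theorem exists_energy_le {H : Space m k → ℝ} (hH : IsFinsler H) (hp : 1 ≤ p)
    (hω₁o : IsOpen ω₁) (hω₁b : Bornology.IsBounded ω₁) (hω₁c : Convex ℝ ω₁) (hω₁0 : 0 ∈ ω₁)
    (hf : MemLp f (ENNReal.conjExponent (ENNReal.ofReal p)) (volume.restrict ω₂)) (w : W10 p ω₂) :
    ∃ B : ℝ, ∀ ℓ : ℝ, 1 < ℓ → ∀ u : W10 p (cylinder ω₁ ω₂ ℓ),
      IsEnergyMinimizer p (cylinder ω₁ ω₂ ℓ) H (fun x => f x.snd) u →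
      energy p (cylinder ω₁ ω₂ ℓ) H (fun x => f x.snd) u ≤
        volume.real ((ℓ - 1) • ω₁) * energy p ω₂ (crossH H) f w +
        (volume.real (ℓ • ω₁) - volume.real ((ℓ - 1) • ω₁)) * B := by
  obtain ⟨M, hM, hb⟩ := hH.exists_bound
  obtain ⟨r, hr, hball⟩ := Metric.isOpen_iff.1 hω₁o 0 hω₁0
  obtain ⟨R, hR, hcut⟩ := exists_cutoff (X := EuclideanSpace ℝ (Fin m)) hr
  obtain ⟨φ, hφ, h1, h2⟩ := w.mem_closure
  -- `M`, `r` and `R` were fixed before `ℓ`, so this bound does not depend on `ℓ`.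
  refine ⟨layerBound p ((M * (R + 1)) ^ p / p) f w, fun ℓ hℓ u hu => ?_⟩
  have hS : Bornology.IsBounded ((ℓ - 1) • ω₁) := hω₁b.smul₀ _
  obtain ⟨ρ, hρ, hρ0, hρ1, hρS, hρR⟩ := hcut _ hS
  have hsub := thickening_smul_subset hω₁c hball hℓ.le
  have hρ' : IsTestFunction (ℓ • ω₁) ρ := ⟨hρ.smooth, hρ.compact, hρ.subset.trans hsub⟩
  have hlim := hH.crossH.tendsto_energy hp hf (fun j => (hφ j).memLp _ _)
    w.memLp_toFun (fun j => (hφ j).memLp_gradient _ _) w.memLp_grad h1 h2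
  refine ge_of_tendsto' ((hlim.const_mul (volume.real ((ℓ - 1) • ω₁))).add
    ((tendsto_layerBound hp ((M * (R + 1)) ^ p / p) hf w hφ h1 h2).const_mul
      (volume.real (ℓ • ω₁) - volume.real ((ℓ - 1) • ω₁)))) fun j => ?_
  exact (hu _).trans (energy_mul_cylinder_le hH hM.le hb hR hp (hω₁b.smul₀ _)
    (hω₁o.smul₀ (by linarith)) (hω₁o.smul₀ (by linarith))
    ((Metric.self_subset_thickening hr _).trans hsub) hf hρ' hρ0 hρ1 hρS hρR (hφ j))

theorem energy_zero {E : Type*} [NormedAddCommGroup E] [InnerProductSpace ℝ E]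
    [FiniteDimensional ℝ E] [MeasurableSpace E] [BorelSpace E] {H : E → ℝ} (hH : IsFinsler H)
    (hp : 1 ≤ p) (Ω : Set E) (g : E → ℝ) :
    energy p Ω H g ((isTestFunction_zero Ω).toW10 p) = 0 := by
  simp [energy, IsTestFunction.toW10, hH.map_zero, Real.zero_rpow (by linarith : p ≠ 0)]

end UpperBound

end FinslerCylinder

end

/-! ### Normalisation by volume and the limit -/

theorem theorem1p2 (m k : ℕ) (hm : 1 ≤ m) (hk : 1 ≤ k)
    (ω₁ : Set (EuclideanSpace ℝ (Fin m))) (ω₂ : Set (EuclideanSpace ℝ (Fin k)))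
    (hω₁_open : IsOpen ω₁) (hω₁_bdd : Bornology.IsBounded ω₁) (hω₁_convex : Convex ℝ ω₁)
    (hω₁_zero : (0 : EuclideanSpace ℝ (Fin m)) ∈ ω₁)
    (hω₂_open : IsOpen ω₂) (hω₂_bdd : Bornology.IsBounded ω₂)
    (H : FinslerCylinder.Space m k → ℝ) (hH : FinslerCylinder.IsFinsler H)
    (p : ℝ) (hp : 1 ≤ p)
    (f : EuclideanSpace ℝ (Fin k) → ℝ)
    (hf : MemLp f (ENNReal.conjExponent (ENNReal.ofReal p)) (volume.restrict ω₂))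
    (u : (ℓ : ℝ) → FinslerCylinder.W10 p (FinslerCylinder.cylinder ω₁ ω₂ ℓ))
    (hu : ∀ ℓ : ℝ, 0 < ℓ →
      FinslerCylinder.IsSolution p (FinslerCylinder.cylinder ω₁ ω₂ ℓ) H (fun x => f x.snd) (u ℓ))
    (uInf : FinslerCylinder.W10 p ω₂)
    (huInf : FinslerCylinder.IsSolution p ω₂ (FinslerCylinder.crossH H) f uInf) :
    Tendsto
      (fun ℓ : ℝ =>
        FinslerCylinder.energy p (FinslerCylinder.cylinder ω₁ ω₂ ℓ) H (fun x => f x.snd) (u ℓ) /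
          volume.real (ℓ • ω₁))
      atTop (𝓝 (FinslerCylinder.energy p ω₂ (FinslerCylinder.crossH H) f uInf)) ∧
    ∃ C : ℝ, 0 < C ∧ ∀ ℓ : ℝ, 0 < ℓ →
      FinslerCylinder.energy p ω₂ (FinslerCylinder.crossH H) f uInf ≤
        FinslerCylinder.energy p (FinslerCylinder.cylinder ω₁ ω₂ ℓ) H (fun x => f x.snd) (u ℓ) /
          volume.real (ℓ • ω₁) ∧
      FinslerCylinder.energy p (FinslerCylinder.cylinder ω₁ ω₂ ℓ) H (fun x => f x.snd) (u ℓ) /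
          volume.real (ℓ • ω₁) ≤
        FinslerCylinder.energy p ω₂ (FinslerCylinder.crossH H) f uInf + C / ℓ := by
  have hf' : ∀ ℓ : ℝ, MemLp (fun x : FinslerCylinder.Space m k => f x.snd)
      (ENNReal.conjExponent (ENNReal.ofReal p))
      (volume.restrict (FinslerCylinder.cylinder ω₁ ω₂ ℓ)) := fun ℓ =>
    FinslerCylinder.memLp_comp_snd hf (hω₁_bdd.smul₀ _)
  have hmin := fun ℓ hℓ => (hu ℓ hℓ).isEnergyMinimizer hH hp (hf' ℓ)
  have hmin' := huInf.isEnergyMinimizer hH.crossH hp hf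
  obtain ⟨B, hB⟩ := FinslerCylinder.exists_energy_le hH hp hω₁_open hω₁_bdd hω₁_convex hω₁_zero
    hf uInf
  set J := FinslerCylinder.energy p ω₂ (FinslerCylinder.crossH H) f uInf
  have hvol : ∀ ℓ : ℝ, 0 ≤ ℓ → volume.real (ℓ • ω₁) = ℓ ^ m * volume.real ω₁ := fun ℓ hℓ => by
    rw [Measure.real, Measure.addHaar_smul, ENNReal.toReal_mul, finrank_euclideanSpace_fin,
      ENNReal.toReal_ofReal (abs_nonneg _), abs_of_nonneg (pow_nonneg hℓ _), Measure.real]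
  have hvol1 : 0 < volume.real ω₁ := ENNReal.toReal_pos
    (hω₁_open.measure_pos volume ⟨0, hω₁_zero⟩).ne' hω₁_bdd.measure_lt_top.ne
  have hvolpos : ∀ ℓ : ℝ, 0 < ℓ → 0 < volume.real (ℓ • ω₁) := fun ℓ hℓ => by
    rw [hvol ℓ hℓ.le]; positivity
  have hbound : ∃ C : ℝ, 0 < C ∧ ∀ ℓ : ℝ, 0 < ℓ →
      J ≤ FinslerCylinder.energy p (FinslerCylinder.cylinder ω₁ ω₂ ℓ) H (fun x => f x.snd) (u ℓ) /
          volume.real (ℓ • ω₁) ∧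
      FinslerCylinder.energy p (FinslerCylinder.cylinder ω₁ ω₂ ℓ) H (fun x => f x.snd) (u ℓ) /
          volume.real (ℓ • ω₁) ≤ J + C / ℓ := by
    -- The first term serves `ℓ > 1`, the second `ℓ ≤ 1`; the `1` ensures positivity.
    refine ⟨m * |B - J| + |J| + 1, by positivity, fun ℓ hℓ => ⟨?_, ?_⟩⟩
    · rw [le_div_iff₀ (hvolpos ℓ hℓ), mul_comm]
      exact hmin'.mul_energy_le hH hp (hω₁_bdd.smul₀ _)
        ((hω₁_open.smul₀ hℓ.ne').measure_pos volume (Set.Nonempty.smul_set ⟨0, hω₁_zero⟩)).ne' hf _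
    rcases le_or_gt ℓ 1 with h1 | h1
    -- For short cylinders, comparison with `0` makes the energy nonpositive, while `J + |J| / ℓ ≥
    -- 0`.
    · have h0 := hmin ℓ hℓ ((FinslerCylinder.isTestFunction_zero _).toW10 p)
      rw [FinslerCylinder.energy_zero hH hp] at h0
      have h2 : |J| ≤ (m * |B - J| + |J| + 1) / ℓ := by
        rw [le_div_iff₀ hℓ]
        have := mul_le_of_le_one_right (abs_nonneg J) h1
        have : 0 ≤ m * |B - J| := by positivity
        linarith
      have h3 := neg_abs_le J
      exact (div_nonpos_of_nonpos_of_nonneg h0 (hvolpos ℓ hℓ).le).trans (by linarith)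
    · have h2 := hB ℓ h1 (u ℓ) (hmin ℓ hℓ)
      -- `θ` is the volume fraction of the core `(ℓ - 1) ω₁` in `ℓ ω₁`; Bernoulli's inequality gives
      -- `1 - θ ≤ m / ℓ`, the source of the rate.
      set θ : ℝ := (1 - 1 / ℓ) ^ m with hθ
      have hinv : 1 / ℓ ≤ 1 := by rw [div_le_one hℓ]; exact h1.le
      have hθ1 : θ ≤ 1 := pow_le_one₀ (by linarith) (by linarith [one_div_pos.2 hℓ])
      have hθm : 1 - θ ≤ m / ℓ := by
        have := one_add_mul_le_pow (a := -(1 / ℓ)) (by linarith) m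
        rw [← sub_eq_add_neg, ← hθ] at this
        have e : (m : ℝ) / ℓ = m * (1 / ℓ) := by ring
        rw [e]
        linarith
      have hS : volume.real ((ℓ - 1) • ω₁) = θ * volume.real (ℓ • ω₁) := by
        rw [hvol _ (by linarith), hvol _ hℓ.le, ← mul_assoc, hθ, ← mul_pow]
        congr 2
        field_simp
      rw [hS] at h2
      -- The normalised bound is the convex combination `θ J + (1 - θ) B`.
      have h3 : FinslerCylinder.energy p (FinslerCylinder.cylinder ω₁ ω₂ ℓ) H (fun x => f x.snd)
          (u ℓ) / volume.real (ℓ • ω₁) ≤ J + (1 - θ) * (B - J) := by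
        rw [div_le_iff₀ (hvolpos ℓ hℓ)]
        linarith
      have h4 : (1 - θ) * (B - J) ≤ m / ℓ * |B - J| :=
        (mul_le_mul_of_nonneg_left (le_abs_self _) (by linarith)).trans
          (mul_le_mul_of_nonneg_right hθm (abs_nonneg _))
      have h5 : (m * |B - J| + |J| + 1) / ℓ = m / ℓ * |B - J| + (|J| + 1) / ℓ := by ring
      have h6 : 0 ≤ (|J| + 1) / ℓ := by positivity
      linarith
  refine ⟨?_, hbound⟩
  obtain ⟨C, -, hC⟩ := hbound
  have hlim : Tendsto (fun ℓ : ℝ => J + C / ℓ) atTop (𝓝 J) := by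
    simpa using (tendsto_const_nhds (x := J)).add (tendsto_const_nhds.div_atTop tendsto_id)
  refine tendsto_of_tendsto_of_tendsto_of_le_of_le' tendsto_const_nhds hlim ?_ ?_
  · filter_upwards [eventually_gt_atTop 0] with ℓ hℓ using (hC ℓ hℓ).1
  · filter_upwards [eventually_gt_atTop 0] with ℓ hℓ using (hC ℓ hℓ).2
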